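/- Let $n\ge 1$, write points of $S^1\times\mathbb{R}^{2n}$, $S^1=\mathbb{R}/2\pi\mathbb{Z}$, as $(\theta,p,z)\in S^1\times\mathbb{R}^{2(n-1)}\times\mathbb{R}^2$, with coordinates $(x_1,y_1,\dots,x_{n-1},y_{n-1})$ of $p$ and $z=(x_n,y_n)$, and let $\lambda_0=d\theta+\sum_{i=1}^n (x_i\,dy_i-y_i\,dx_i)$ and $\xi_0=\ker\lambda_0$. **Definitions.** For a contact form $\lambda$ let $X_\lambda$ be its Reeb vector field ($\lambda(X_\lambda)=1$, $i_{X_\lambda}d\lambda=0$) and $\pi_\lambda$ the projection of the tangent bundle onto $\ker\lambda$ along $X_\lambda$. A smooth complex structure $J$ on $\xi_0$ is *compatible* if $d\lambda_0(\cdot,J\cdot)$ is symmetric and positive definite on $\xi_0$. A *finite-energy cylinder* for the data $(\lambda,J)$ is a pair of smooth maps $a:\mathbb{R}\times\mathbb{R}/\mathbb{Z}\to\mathbb{R}$, $u:\mathbb{R}\times\mathbb{R}/\mathbb{Z}\to S^1\times\mathbb{R}^{2n}$ with $\pi_\lambda\circ du\circ j=J\circ\pi_\lambda\circ du$ and $u^*\lambda\circ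 j=da$, where $j\partial_s=\partial_t$, $j\partial_t=-\partial_s$, and with finite Hofer energy $$E(u)=\sup_\varphi\int_{\mathbb{R}\times\mathbb{R}/\mathbb{Z}}d(\varphi(a)\,u^*\lambda)<\infty,$$ the supremum being over all smooth $\varphi:\mathbb{R}\to[0,1]$ with $\varphi'\ge 0$, $\varphi(-\infty)=0$ and $\varphi(\infty)=1$. Its *limit set* is the collection of all periodic orbits $\gamma:\mathbb{R}/\mathbb{Z}\to S^1\times\mathbb{R}^{2n}$, $\dot\gamma=T\cdot X_\lambda\circ\gamma$ with $T\ne 0$, that are limits in $C^\infty(\mathbb{R}/\mathbb{Z},S^1\times\mathbb{R}^{2n})$ of loops $u\circ\psi(s_k,\cdot)$ with $s_k\to\infty$, where $\psi:[0,\infty)\times\mathbb{R}/\mathbb{Z}\to\mathbb{R}\times\mathbb{R}/\mathbb{Z}$ is a holomorphic cylindrical coordinate system around one of the two punctures $s=\pm\infty$, that is, a holomorphic embedding such that, as $s\to\infty$, $\psi(s,t)$ tends to that puncture. **Theorem.** Let $r_+>r_->0$. Then there exist a smooth function $F:S^1\times\mathbb{R}^{2n}\to\mathbb{R}$ and a compatible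 complex structure $J$ on $\xi_0$ such that through every point $(\theta_0,p,z)$ with $|z|\in(r_-,r_+)$ passes a finite-energy cylinder for the data $(e^F\lambda_0,J)$ such that the union of the images of the periodic orbits in its limit set is equal to $$\bigl(S^1\times\{p\}\times\{|z|=r_-\}\bigr)\cup\bigl(S^1\times\{p\}\times\{|z|=r_+\}\bigr).$$ -/

import Mathlib

open Set Filter Topology MeasureTheory
open scoped ContDiff ENNReal

noncomputable section

namespace KnotModel

/-! ### Calculus on products of circles and vector spaces

The manifolds `ℝ × ℝ/ℤ` and `ℝ/2πℤ × ℂⁿ` are quotients of a normed space `V` by a discrete group of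
translations.  Each of them is an additive group `G` with the covering homomorphism `e : V → G` and
a section `l : G → V` of it which near `0` is the inverse of `e`.  Translations trivialize the
tangent bundle: the tangent space at every point is `V`, and `x ↦ g + e x`, `x` near `0`, is a chart
around `g`.  For maps into a normed space, `l = id`. -/

section Calculus

variable {V G W H : Type*} [NormedAddCommGroup V] [NormedSpace ℝ V] [AddGroup G]
  [NormedAddCommGroup W] [NormedSpace ℝ W] [AddGroup H]

/-- The expression of a map `f : G → H` in the charts around `g` and around `f g`. -/
def localRep (e : V → G) (l : H → W) (f : G → H) (g : G) : V → W :=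
  fun x => l (f (g + e x) - f g)

/-- `f` is of class `C^∞` at `g`. -/
def SmoothAt (e : V → G) (l : H → W) (f : G → H) (g : G) : Prop :=
  ContDiffAt ℝ ∞ (localRep e l f g) 0

/-- The differential of `f` at `g`. -/
def differential (e : V → G) (l : H → W) (f : G → H) (g : G) : V →L[ℝ] W :=
  fderiv ℝ (localRep e l f g) 0

/-- The exterior derivative `dη(v, w)` of a one-form `η` at the point `g`. -/
def extd (e : V → G) (η : G → V →L[ℝ] ℝ) (g : G) (v w : V) : ℝ :=
  differential e id η g v w - differential e id η g w v

end Calculus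

/-! ### The two manifolds -/

/-- The cylinder `ℝ × ℝ/ℤ` with coordinates `(s, t)`; its tangent spaces are `ℝ × ℝ`. -/
abbrev Cyl : Type := ℝ × UnitAddCircle

/-- The covering map `ℝ × ℝ → ℝ × ℝ/ℤ`. -/
def Cyl.exp (x : ℝ × ℝ) : Cyl := (x.1, (x.2 : UnitAddCircle))

/-- The section of `Cyl.exp` with second component in `(-1/2, 1/2]`. -/
def Cyl.log (c : Cyl) : ℝ × ℝ := (c.1, (AddCircle.equivIoc (1 : ℝ) (-1 / 2) c.2 : ℝ))

/-- The complex structure of the cylinder: `∂_s ↦ ∂_t`, `∂_t ↦ -∂_s`. -/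
def Cyl.rot (v : ℝ × ℝ) : ℝ × ℝ := (-v.2, v.1)

/-- The manifold `S¹ × ℝ²ⁿ`, where `S¹ = ℝ/2πℤ` and the point `(x_i, y_i)_i` of `ℝ²ⁿ` is written
as `(x_i + √-1 y_i)_i`. -/
abbrev Model (n : ℕ) : Type := Real.Angle × (Fin n → ℂ)

/-- The tangent spaces of `Model n`; `(1, 0)` is `∂_θ`. -/
abbrev TModel (n : ℕ) : Type := ℝ × (Fin n → ℂ)

/-- The covering map `ℝ × ℝ²ⁿ → S¹ × ℝ²ⁿ`. -/
def Model.exp {n : ℕ} (x : TModel n) : Model n := ((x.1 : Real.Angle), x.2)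

/-- The section of `Model.exp` with first component in `(-π, π]`. -/
def Model.log {n : ℕ} (m : Model n) : TModel n := (m.1.toReal, m.2)

variable {n : ℕ}

/-- The coordinate one-form `dx_i`. -/
def dx (i : Fin n) : TModel n →L[ℝ] ℝ :=
  Complex.reCLM.comp
    ((ContinuousLinearMap.proj (R := ℝ) (φ := fun _ : Fin n => ℂ) i).comp
      (ContinuousLinearMap.snd ℝ ℝ (Fin n → ℂ)))

/-- The coordinate one-form `dy_i`. -/
def dy (i : Fin n) : TModel n →L[ℝ] ℝ :=
  Complex.imCLM.comp
    ((ContinuousLinearMap.proj (R := ℝ) (φ := fun _ : Fin n => ℂ) i).comp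
      (ContinuousLinearMap.snd ℝ ℝ (Fin n → ℂ)))

/-- The contact form `λ₀ = dθ + ∑ i, (x_i dy_i - y_i dx_i)`. -/
def lam0 (n : ℕ) (m : Model n) : TModel n →L[ℝ] ℝ :=
  ContinuousLinearMap.fst ℝ ℝ (Fin n → ℂ) + ∑ i : Fin n, ((m.2 i).re • dy i - (m.2 i).im • dx i)

/-- The one-form `e^F λ`. -/
def conformal (F : Model n → ℝ) (lam : Model n → TModel n →L[ℝ] ℝ) (m : Model n) :
    TModel n →L[ℝ] ℝ :=
  Real.exp (F m) • lam m

/-! ### Contact geometry -/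

/-- The value of `dλ` at `m`. -/
def dlam (lam : Model n → TModel n →L[ℝ] ℝ) (m : Model n) (v w : TModel n) : ℝ :=
  extd Model.exp lam m v w

/-- `X` is a Reeb vector of `λ` at `m`: `λ(X) = 1` and `i_X dλ = 0`. -/
def IsReebVector (lam : Model n → TModel n →L[ℝ] ℝ) (m : Model n) (X : TModel n) : Prop :=
  lam m X = 1 ∧ ∀ v, dlam lam m X v = 0

/-- The Reeb vector field: its value at `m` is the Reeb vector at `m`, which exists and is unique
if `λ` is a contact form. -/
def reeb (lam : Model n → TModel n →L[ℝ] ℝ) (m : Model n) : TModel n :=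
  Classical.epsilon (IsReebVector lam m)

/-- The projection `π_λ` of the tangent space at `m` onto `ξ = ker λ` along the Reeb vector. -/
def projXi (lam : Model n → TModel n →L[ℝ] ℝ) (m : Model n) (v : TModel n) : TModel n :=
  v - lam m v • reeb lam m

/-- `J` is a (smooth) complex structure on `ξ = ker λ` compatible with `dλ`.  An endomorphism of `ξ`
is written as an endomorphism of the tangent bundle that preserves `ξ`; only its restriction to `ξ`
matters. -/
structure IsCompatible (lam : Model n → TModel n →L[ℝ] ℝ)
    (J : Model n → TModel n →L[ℝ] TModel n) : Prop where
  smooth : ∀ m, SmoothAt Model.exp id J m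
  mapsTo : ∀ m v, lam m v = 0 → lam m (J m v) = 0
  sq : ∀ m v, lam m v = 0 → J m (J m v) = -v
  symm : ∀ m v w, lam m v = 0 → lam m w = 0 → dlam lam m v (J m w) = dlam lam m w (J m v)
  pos : ∀ m v, lam m v = 0 → v ≠ 0 → 0 < dlam lam m v (J m v)

/-! ### Pseudoholomorphic cylinders -/

/-- The differential of a map from the cylinder to `Model n`. -/
def du (u : Cyl → Model n) (c : Cyl) : ℝ × ℝ →L[ℝ] TModel n :=
  differential Cyl.exp Model.log u c

/-- `(a, u)` is a pseudoholomorphic map from the cylinder for the data `(λ, J)`: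
`π_λ ∘ du ∘ j = J ∘ π_λ ∘ du` and `u^*λ ∘ j = da`. -/
structure IsPseudoholomorphic (lam : Model n → TModel n →L[ℝ] ℝ)
    (J : Model n → TModel n →L[ℝ] TModel n) (a : Cyl → ℝ) (u : Cyl → Model n) : Prop where
  smooth_a : ∀ c, SmoothAt Cyl.exp id a c
  smooth_u : ∀ c, SmoothAt Cyl.exp Model.log u c
  eq_xi : ∀ c v, projXi lam (u c) (du u c (Cyl.rot v)) = J (u c) (projXi lam (u c) (du u c v))
  eq_reeb : ∀ c v, lam (u c) (du u c (Cyl.rot v)) = differential Cyl.exp id a c v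

/-- The smooth increasing functions `ℝ → [0, 1]` with limits `0` at `-∞` and `1` at `∞`. -/
def cutoffs : Set (ℝ → ℝ) :=
  {φ | ContDiff ℝ ∞ φ ∧ (∀ x, φ x ∈ Icc (0 : ℝ) 1) ∧ (∀ x, 0 ≤ deriv φ x) ∧
    Tendsto φ atBot (𝓝 0) ∧ Tendsto φ atTop (𝓝 1)}

/-- The pullback `u^*λ`. -/
def pullback (lam : Model n → TModel n →L[ℝ] ℝ) (u : Cyl → Model n) (c : Cyl) : ℝ × ℝ →L[ℝ] ℝ :=
  (lam (u c)).comp (du u c)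

/-- The Hofer energy: the supremum over `φ` of the integral of the two-form `d(φ(a) u^*λ)` over the
cylinder.  For a pseudoholomorphic map and a compatible `J`, the density of this form with respect
to `ds ∧ dt` is nonnegative, so that `ENNReal.ofReal` does not change it. -/
def hoferEnergy (lam : Model n → TModel n →L[ℝ] ℝ) (a : Cyl → ℝ) (u : Cyl → Model n) : ℝ≥0∞ :=
  ⨆ φ ∈ cutoffs, ∫⁻ c : Cyl,
    ENNReal.ofReal (extd Cyl.exp (fun c' => φ (a c') • pullback lam u c') c (1, 0) (0, 1))

/-- A finite-energy cylinder for the data `(λ, J)`. -/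
def IsFiniteEnergyCylinder (lam : Model n → TModel n →L[ℝ] ℝ)
    (J : Model n → TModel n →L[ℝ] TModel n) (a : Cyl → ℝ) (u : Cyl → Model n) : Prop :=
  IsPseudoholomorphic lam J a u ∧ hoferEnergy lam a u < (⊤ : ℝ≥0∞)

/-! ### Limit sets -/

/-- `ψ`, restricted to `[0, ∞) × ℝ/ℤ`, is a holomorphic cylindrical coordinate system around one of
the two punctures of the cylinder: the puncture `s = ∞` if `p = atTop`, and the puncture `s = -∞` if
`p = atBot`. -/
structure IsCylindricalCoordinates (p : Filter ℝ) (ψ : Cyl → Cyl) : Prop where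
  continuousOn : ContinuousOn ψ {c | 0 ≤ c.1}
  injOn : InjOn ψ {c | 0 ≤ c.1}
  smooth : ∀ c : Cyl, 0 < c.1 → SmoothAt Cyl.exp Cyl.log ψ c
  holomorphic : ∀ c : Cyl, 0 < c.1 → ∀ v,
    differential Cyl.exp Cyl.log ψ c (Cyl.rot v) = Cyl.rot (differential Cyl.exp Cyl.log ψ c v)
  tendsto : ∀ t : UnitAddCircle, Tendsto (fun s : ℝ => (ψ (s, t)).1) atTop p

/-- The expression `x ↦ v(t + x) - v(t)` near `x = 0` of a loop `v`, lifted to `ℝ × ℝ²ⁿ`. -/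
def loopRep (v : UnitAddCircle → Model n) (t : UnitAddCircle) : ℝ → TModel n :=
  localRep (fun x : ℝ => (x : UnitAddCircle)) Model.log v t

/-- The derivative of order `k ≥ 1` of a loop. -/
def loopDeriv (k : ℕ) (v : UnitAddCircle → Model n) (t : UnitAddCircle) : TModel n :=
  iteratedDeriv k (loopRep v t) 0

/-- `γ` is a smooth loop. -/
def IsSmoothLoop (γ : UnitAddCircle → Model n) : Prop :=
  ∀ t, ContDiffAt ℝ ∞ (loopRep γ t) 0

/-- `γ` is a periodic orbit of the Reeb vector field: a smooth loop with `γ' = T • X_λ ∘ γ` for a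
number `T ≠ 0`. -/
def IsPeriodicOrbit (lam : Model n → TModel n →L[ℝ] ℝ) (γ : UnitAddCircle → Model n) : Prop :=
  IsSmoothLoop γ ∧ ∃ T : ℝ, T ≠ 0 ∧ ∀ t, loopDeriv 1 γ t = T • reeb lam (γ t)

/-- Convergence of loops in `C^∞(ℝ/ℤ, S¹ × ℝ²ⁿ)`: uniform convergence of the loops and of their
derivatives of each order. -/
def TendstoSmoothly (v : ℕ → UnitAddCircle → Model n) (γ : UnitAddCircle → Model n) : Prop :=
  TendstoUniformly v γ atTop ∧
    ∀ k : ℕ, 1 ≤ k → TendstoUniformly (fun j t => loopDeriv k (v j) t) (loopDeriv k γ) atTop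

/-- The limit set of a map from the cylinder: the collection of all periodic orbits that are
`C^∞`-limits of loops `u(ψ(s_j, ·))`, where `ψ` is a holomorphic cylindrical coordinate system around
one of the two punctures and `s_j → ∞`. -/
def limitSet (lam : Model n → TModel n →L[ℝ] ℝ) (u : Cyl → Model n) :
    Set (UnitAddCircle → Model n) :=
  {γ | IsPeriodicOrbit lam γ ∧ ∃ (p : Filter ℝ) (ψ : Cyl → Cyl) (s : ℕ → ℝ),
    (p = atTop ∨ p = atBot) ∧ IsCylindricalCoordinates p ψ ∧ Tendsto s atTop atTop ∧
      TendstoSmoothly (fun j t => u (ψ (s j, t))) γ}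

/-- The torus `S¹ × {p} × {|z| = r}` in `S¹ × ℝ²ⁿ × ℝ²`. -/
def torus (p : Fin n → ℂ) (r : ℝ) : Set (Model (n + 1)) :=
  {m | (∀ i, m.2 (Fin.castSucc i) = p i) ∧ ‖m.2 (Fin.last n)‖ = r}

end KnotModel

end

open KnotModel

open Set Filter Topology MeasureTheory
open scoped ContDiff ENNReal

noncomputable section

namespace KnotModel

/-! ### A flat oscillating function -/

/-! The problem reduces to a gradient flow in the plane. Take `F = G(z)` and let `J` be
multiplication by `i`, lifted to `ξ₀`. The Reeb field of `e^F λ₀` is `e^{-G}(∂_θ + X)`, where `X` is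
the lift to `ξ₀` of `-(i/2)∇G`, so `J X` is the lift of `∇G/2`. Let `z' = π ∇G(z)`, choose `θ` so
that `s ↦ (θ(s), p, z(s))` is tangent to `ξ₀`, and put `u(s, t) = (θ(s) + 2πt, p, z(s))`. Then `∂_s
u = 2π J X`, and the projection of `∂_t u` is `-2π X = J ∂_s u`. The function `a` only has to
satisfy `a' = 2π e^{G(z)}` (`isPseudoholomorphic_rotCylinder`). Since `G` increases along its
gradient lines and `G ≤ 1`, the energy is at most `2πe`.

Over a critical point of `G` the Reeb field is a multiple of `∂_θ`, and the circle fibres are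
periodic orbits. The loops `u(s, ·)` are translates of such fibres, so the limit set is governed by
the accumulation points of `z` at `s = ±∞` (`iUnion_limitSet_rotCylinder`). What is needed is a
smooth `G` whose gradient lines in the annulus accumulate on the whole of both boundary circles, all
of whose points are critical (`exists_spiralling_potential`).

In polar coordinates, with `x` affine in `|z|²`, put `ℓ = 1/(1-x) - 1/x`, `S = 1/(1 + e^{-ℓ})` and
`G = S + (1/2) S(1-S) sin(φ - 2ℓ)`. The factor `S(1-S)` is flat at both circles and absorbs the
oscillation. Along a gradient line the phase `ψ = φ - 2ℓ` increases where `ψ ∈ 2πℤ` and decreases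
where `ψ ∈ π + 2πℤ`, hence stays bounded. There are no critical points inside the annulus, so `x`
tends to `1` and `0`, `ℓ` to `±∞`, and `φ = ψ + 2ℓ` winds infinitely often at both ends. -/

/-- The function `exp (-(1 + κ i) / x)`, extended by `0` to `x ≤ 0`. -/
def flatSpiral (κ x : ℝ) : ℂ :=
  if x ≤ 0 then 0 else Complex.exp (-((1 + κ * Complex.I) * (x : ℂ)⁻¹))

section flatSpiral

variable (κ : ℝ) {x : ℝ}

theorem flatSpiral_of_nonpos (hx : x ≤ 0) : flatSpiral κ x = 0 := by simp [flatSpiral, hx]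

theorem flatSpiral_of_pos (hx : 0 < x) :
    flatSpiral κ x = Complex.exp (-((1 + κ * Complex.I) * (x : ℂ)⁻¹)) := by
  simp [flatSpiral, hx.not_ge]

theorem flatSpiral_of_pos' (hx : 0 < x) :
    flatSpiral κ x = (expNegInvGlue x : ℂ) * Complex.exp ((-(κ * x⁻¹) : ℝ) * Complex.I) := by
  rw [flatSpiral_of_pos κ hx, expNegInvGlue, if_neg hx.not_ge, Complex.ofReal_exp,
    ← Complex.exp_add]
  congr 1
  push_cast
  ring

theorem norm_flatSpiral (x : ℝ) : ‖flatSpiral κ x‖ = expNegInvGlue x := by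
  rcases le_or_gt x 0 with hx | hx
  · simp [flatSpiral_of_nonpos κ hx, expNegInvGlue.zero_of_nonpos hx]
  · rw [flatSpiral_of_pos' κ hx, norm_mul, Complex.norm_exp_ofReal_mul_I, mul_one,
      Complex.norm_real, Real.norm_of_nonneg (expNegInvGlue.nonneg x)]

open Polynomial in
-- The oscillating phase has modulus one, so the decay is that of `expNegInvGlue`.
theorem tendsto_polynomial_mul_flatSpiral (p : ℂ[X]) :
    Tendsto (fun x : ℝ => p.eval (x : ℂ)⁻¹ * flatSpiral κ x) (𝓝 0) (𝓝 0) := by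
  induction p using Polynomial.induction_on' with
  | add p q hp hq => simpa [add_mul] using hp.add hq
  | monomial n a =>
    rw [tendsto_zero_iff_norm_tendsto_zero]
    have h := ((expNegInvGlue.tendsto_polynomial_inv_mul_zero (X ^ n)).norm).const_mul ‖a‖
    simp only [norm_zero, mul_zero] at h
    refine h.congr fun x => ?_
    simp only [eval_pow, eval_X, eval_monomial, norm_mul, norm_pow, norm_inv, norm_flatSpiral,
      Complex.norm_real, Real.norm_of_nonneg (expNegInvGlue.nonneg x)]
    ring

open Polynomial in
-- The family `p(1/x) * flatSpiral κ x` is closed under differentiation; smoothness then follows by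
-- induction on the order, for all `p` at once.
theorem hasDerivAt_polynomial_mul_flatSpiral (p : ℂ[X]) (x : ℝ) :
    HasDerivAt (fun x : ℝ => p.eval (x : ℂ)⁻¹ * flatSpiral κ x)
      ((X ^ 2 * (C (1 + κ * Complex.I) * p - derivative p)).eval (x : ℂ)⁻¹ * flatSpiral κ x) x := by
  rcases lt_trichotomy x 0 with hx | rfl | hx
  · rw [flatSpiral_of_nonpos κ hx.le, mul_zero]
    refine (hasDerivAt_const _ 0).congr_of_eventuallyEq ?_
    filter_upwards [gt_mem_nhds hx] with y hy
    rw [flatSpiral_of_nonpos κ hy.le, mul_zero]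
  · rw [flatSpiral_of_nonpos κ le_rfl, mul_zero, hasDerivAt_iff_tendsto_slope]
    -- The difference quotient at `0` is the member of the same family with polynomial `p * X`.
    refine ((tendsto_polynomial_mul_flatSpiral κ (p * X)).mono_left inf_le_left).congr fun x => ?_
    simp [slope_def_module, flatSpiral_of_nonpos κ le_rfl, mul_left_comm, mul_assoc]
  · have hx0 : (x : ℂ) ≠ 0 := by exact_mod_cast hx.ne'
    have h1 : HasDerivAt (fun z : ℂ => p.eval z⁻¹ * Complex.exp (-((1 + κ * Complex.I) * z⁻¹)))
        _ (x : ℂ) :=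
      ((p.hasDerivAt (x : ℂ)⁻¹).comp (x : ℂ) (hasDerivAt_inv hx0)).mul
        ((((hasDerivAt_inv hx0).const_mul (1 + κ * Complex.I)).neg).cexp)
    have h2 := h1.comp_ofReal
    refine (h2.congr_of_eventuallyEq ?_).congr_deriv ?_
    · filter_upwards [lt_mem_nhds hx] with y hy
      rw [flatSpiral_of_pos κ hy]
    · rw [flatSpiral_of_pos κ hx]
      simp
      ring

open Polynomial in
theorem contDiff_polynomial_mul_flatSpiral (p : ℂ[X]) :
    ContDiff ℝ ∞ (fun x : ℝ => p.eval (x : ℂ)⁻¹ * flatSpiral κ x) := by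
  refine contDiff_infty.2 fun m => ?_
  induction m generalizing p with
  | zero =>
    exact contDiff_zero.2 (Differentiable.continuous (𝕜 := ℝ) fun x =>
      (hasDerivAt_polynomial_mul_flatSpiral κ p x).differentiableAt)
  | succ m ih =>
    rw [show ((m + 1 : ℕ) : WithTop ℕ∞) = m + 1 from rfl]
    refine contDiff_succ_iff_deriv.2 ⟨fun x =>
      (hasDerivAt_polynomial_mul_flatSpiral κ p x).differentiableAt, by simp, ?_⟩
    convert! ih (X ^ 2 * (C (1 + κ * Complex.I) * p - derivative p)) using 2
    exact (hasDerivAt_polynomial_mul_flatSpiral κ p _).deriv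

theorem contDiff_flatSpiral : ContDiff ℝ ∞ (flatSpiral κ) := by
  simpa using contDiff_polynomial_mul_flatSpiral κ 1

end flatSpiral

/-! ### The potential -/

/-- The inverse `1 / (1 - x) - 1 / x` of the logistic reparametrization of
`Real.smoothTransition`. -/
def logit (x : ℝ) : ℝ := (1 - x)⁻¹ - x⁻¹

theorem hasDerivAt_logit {x : ℝ} (h0 : x ≠ 0) (h1 : x ≠ 1) :
    HasDerivAt logit (((1 - x) ^ 2)⁻¹ + (x ^ 2)⁻¹) x := by
  have h := (((hasDerivAt_id x).const_sub 1).fun_inv (sub_ne_zero.2 h1.symm)).sub (hasDerivAt_inv h0)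
  refine h.congr_deriv ?_
  simp

theorem smoothTransition_eq_logistic {x : ℝ} (h0 : 0 < x) (h1 : x < 1) :
    Real.smoothTransition x = (1 + Real.exp (-logit x))⁻¹ := by
  have h1' : ¬ (1 - x ≤ 0) := by linarith
  have : Real.exp (-logit x) = Real.exp (-(1 - x)⁻¹) / Real.exp (-x⁻¹) := by
    rw [← Real.exp_sub, logit]; ring_nf
  rw [Real.smoothTransition, expNegInvGlue, expNegInvGlue, if_neg h0.not_ge, if_neg h1', this]
  have := Real.exp_pos (-x⁻¹)
  field_simp

/-- The logistic function satisfies `σ' = σ(1 - σ)`, and the transition function is `σ ∘ logit`. -/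
theorem hasDerivAt_smoothTransition {x : ℝ} (h0 : 0 < x) (h1 : x < 1) :
    HasDerivAt Real.smoothTransition (Real.smoothTransition x * (1 - Real.smoothTransition x) *
      (((1 - x) ^ 2)⁻¹ + (x ^ 2)⁻¹)) x := by
  have hpos : (0 : ℝ) < 1 + Real.exp (-logit x) := by positivity
  have h := (((hasDerivAt_logit h0.ne' h1.ne).neg.exp).const_add 1).fun_inv hpos.ne'
  have h' : HasDerivAt Real.smoothTransition _ x := h.congr_of_eventuallyEq (by
    filter_upwards [Ioo_mem_nhds h0 h1] with y hy
    exact smoothTransition_eq_logistic hy.1 hy.2)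
  refine h'.congr_deriv ?_
  rw [smoothTransition_eq_logistic h0 h1]
  field_simp
  simp
  ring

/-- The flat factor `S (1 - S) exp (-2 i logit x)` of the potential, where `S` is the smooth
transition function. -/
def spiralCoeff (x : ℝ) : ℂ :=
  flatSpiral (-2) x * flatSpiral 2 (1 - x) *
    ((((expNegInvGlue x + expNegInvGlue (1 - x)) ^ 2)⁻¹ : ℝ) : ℂ)

theorem contDiff_spiralCoeff : ContDiff ℝ ∞ spiralCoeff := by
  have hg : ContDiff ℝ ∞ expNegInvGlue := expNegInvGlue.contDiff
  refine ((contDiff_flatSpiral (-2)).mul ((contDiff_flatSpiral 2).comp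
    (contDiff_const.sub contDiff_id))).mul (Complex.ofRealCLM.contDiff.comp
      (((hg.add (hg.comp (contDiff_const.sub contDiff_id))).pow 2).inv fun x => ?_))
  exact pow_ne_zero _ (Real.smoothTransition.pos_denom x).ne'

theorem spiralCoeff_of_nonpos {x : ℝ} (hx : x ≤ 0) : spiralCoeff x = 0 := by
  simp [spiralCoeff, flatSpiral_of_nonpos _ hx]

theorem spiralCoeff_of_one_le {x : ℝ} (hx : 1 ≤ x) : spiralCoeff x = 0 := by
  simp [spiralCoeff, flatSpiral_of_nonpos _ (sub_nonpos.2 hx)]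

/-- The phases `2/x` and `-2/(1-x)` of the two flat factors add up to `-2 logit x`, and their moduli
over the squared denominator give `S(1-S)`. -/
theorem spiralCoeff_of_mem {x : ℝ} (h0 : 0 < x) (h1 : x < 1) :
    spiralCoeff x = ((Real.smoothTransition x * (1 - Real.smoothTransition x) : ℝ) : ℂ) *
      Complex.exp ((-(2 * logit x) : ℝ) * Complex.I) := by
  have hd := (Real.smoothTransition.pos_denom x).ne'
  have hS : Real.smoothTransition x * (1 - Real.smoothTransition x) =
      expNegInvGlue x * expNegInvGlue (1 - x) *
        ((expNegInvGlue x + expNegInvGlue (1 - x)) ^ 2)⁻¹ := by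
    rw [Real.smoothTransition]; field_simp; ring
  have he : Complex.exp ((-(2 * logit x) : ℝ) * Complex.I) =
      Complex.exp ((-(-2 * x⁻¹) : ℝ) * Complex.I) *
        Complex.exp ((-(2 * (1 - x)⁻¹) : ℝ) * Complex.I) := by
    rw [← Complex.exp_add, logit]; congr 1; push_cast; ring
  rw [spiralCoeff, flatSpiral_of_pos' _ h0, flatSpiral_of_pos' _ (sub_pos.2 h1), hS, he]
  push_cast
  ring

variable {rm rp : ℝ}

/-- The affine function of `‖z‖²` with values `0` and `1` on the circles of radius `rm`, `rp`. -/
def annulusCoord (rm rp : ℝ) (z : ℂ) : ℝ := (‖z‖ ^ 2 - rm ^ 2) / (rp ^ 2 - rm ^ 2)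

/-- The potential whose gradient lines in the annulus `rm < ‖z‖ < rp` wind around both boundary
circles infinitely often. -/
def spiralPotential (rm rp : ℝ) (z : ℂ) : ℝ :=
  Real.smoothTransition (annulusCoord rm rp z) +
    1 / 2 * ((z * spiralCoeff (annulusCoord rm rp z)).im / ‖z‖)

theorem sq_sub_sq_pos (h0 : 0 < rm) (h : rm < rp) : 0 < rp ^ 2 - rm ^ 2 := by nlinarith

theorem annulusCoord_pos_iff (h0 : 0 < rm) (h : rm < rp) {z : ℂ} :
    0 < annulusCoord rm rp z ↔ rm < ‖z‖ := by
  rw [annulusCoord, div_pos_iff_of_pos_right (sq_sub_sq_pos h0 h), sub_pos,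
    sq_lt_sq₀ h0.le (norm_nonneg z)]

theorem annulusCoord_lt_one_iff (h0 : 0 < rm) (h : rm < rp) {z : ℂ} :
    annulusCoord rm rp z < 1 ↔ ‖z‖ < rp := by
  rw [annulusCoord, div_lt_one (sq_sub_sq_pos h0 h), sub_lt_sub_iff_right,
    sq_lt_sq₀ (norm_nonneg z) (h0.trans h).le]

theorem contDiff_annulusCoord : ContDiff ℝ ∞ (annulusCoord rm rp) :=
  ((contDiff_norm_sq ℝ).sub contDiff_const).div_const _

theorem spiralPotential_of_norm_le (h0 : 0 < rm) (h : rm < rp) {z : ℂ} (hz : ‖z‖ ≤ rm) :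
    spiralPotential rm rp z = 0 := by
  have hx : annulusCoord rm rp z ≤ 0 := by
    rw [← not_lt, annulusCoord_pos_iff h0 h]; exact hz.not_gt
  simp [spiralPotential, spiralCoeff_of_nonpos hx, hx]

theorem spiralPotential_of_le_norm (h0 : 0 < rm) (h : rm < rp) {z : ℂ} (hz : rp ≤ ‖z‖) :
    spiralPotential rm rp z = 1 := by
  have hx : 1 ≤ annulusCoord rm rp z := by
    rw [← not_lt, annulusCoord_lt_one_iff h0 h]; exact hz.not_gt
  simp [spiralPotential, spiralCoeff_of_one_le hx, hx]

/-- Only the division by `‖z‖` could fail to be smooth, and near `0` the potential vanishes. -/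
theorem contDiff_spiralPotential (h0 : 0 < rm) (h : rm < rp) :
    ContDiff ℝ ∞ (spiralPotential rm rp) := by
  rw [contDiff_iff_contDiffAt]
  intro z
  by_cases hz : z = 0
  · subst hz
    refine (contDiffAt_const (c := (0 : ℝ))).congr_of_eventuallyEq ?_
    filter_upwards [Metric.ball_mem_nhds (0 : ℂ) h0] with w hw
    exact spiralPotential_of_norm_le h0 h (by simpa using (mem_ball_zero_iff.1 hw).le)
  · have hx : ContDiffAt ℝ ∞ (annulusCoord rm rp) z := contDiff_annulusCoord.contDiffAt
    have hS : ContDiff ℝ ∞ Real.smoothTransition := Real.smoothTransition.contDiff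
    refine (hS.contDiffAt.comp z hx).add (contDiffAt_const.mul (ContDiffAt.div ?_
      (contDiffAt_norm ℝ hz) (norm_ne_zero_iff.2 hz)))
    exact Complex.imCLM.contDiff.contDiffAt.comp z
      (contDiffAt_id.mul (contDiff_spiralCoeff.contDiffAt.comp z hx))

/-- The potential in polar coordinates. -/
def polarPotential (x φ : ℝ) : ℝ :=
  Real.smoothTransition x + 1 / 2 * (Real.smoothTransition x * (1 - Real.smoothTransition x) *
    Real.sin (φ - 2 * logit x))

theorem annulusCoord_exp (w : ℂ) :
    annulusCoord rm rp (Complex.exp w) =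
      (Real.exp (2 * w.re) - rm ^ 2) / (rp ^ 2 - rm ^ 2) := by
  rw [annulusCoord, Complex.norm_exp, ← Real.exp_nat_mul]
  norm_num

theorem spiralPotential_exp (h0 : 0 < rm) (h : rm < rp) {w : ℂ} (h1 : rm < ‖Complex.exp w‖)
    (h2 : ‖Complex.exp w‖ < rp) :
    spiralPotential rm rp (Complex.exp w) =
      polarPotential (annulusCoord rm rp (Complex.exp w)) w.im := by
  rw [← annulusCoord_pos_iff h0 h] at h1
  rw [← annulusCoord_lt_one_iff h0 h] at h2
  rw [spiralPotential, polarPotential, spiralCoeff_of_mem h1 h2]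
  have hw : Complex.exp w = (Real.exp w.re : ℂ) * Complex.exp (w.im * Complex.I) := by
    rw [Complex.ofReal_exp, ← Complex.exp_add, Complex.re_add_im]
  have hn : ‖Complex.exp w‖ = Real.exp w.re := Complex.norm_exp w
  generalize annulusCoord rm rp (Complex.exp w) = x
  rw [hn, hw]
  set B := Real.smoothTransition x * (1 - Real.smoothTransition x)
  have : (Real.exp w.re : ℂ) * Complex.exp (w.im * Complex.I) *
      ((B : ℂ) * Complex.exp ((-(2 * logit x) : ℝ) * Complex.I)) =
      ((Real.exp w.re * B : ℝ) : ℂ) * Complex.exp ((w.im - 2 * logit x : ℝ) * Complex.I) := by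
    have e : Complex.exp ((w.im - 2 * logit x : ℝ) * Complex.I) = Complex.exp (w.im * Complex.I) *
        Complex.exp ((-(2 * logit x) : ℝ) * Complex.I) := by
      rw [← Complex.exp_add]; congr 1; push_cast; ring
    rw [e]; push_cast; ring
  rw [this, Complex.im_ofReal_mul, Complex.exp_ofReal_mul_I_im]
  have := Real.exp_pos w.re
  field_simp

/-! ### Radial and angular derivatives of the potential -/

/-- The derivative of `logit ∘ annulusCoord` with respect to `log ‖z‖`. -/
def logitSpeed (rm rp : ℝ) (z : ℂ) : ℝ :=
  (((1 - annulusCoord rm rp z) ^ 2)⁻¹ + (annulusCoord rm rp z ^ 2)⁻¹) *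
    (2 * ‖z‖ ^ 2 / (rp ^ 2 - rm ^ 2))

theorem logitSpeed_pos (h0 : 0 < rm) (h : rm < rp) {z : ℂ} (h1 : rm < ‖z‖) (h2 : ‖z‖ < rp) :
    0 < logitSpeed rm rp z := by
  have a := (annulusCoord_pos_iff h0 h).2 h1
  have b := sub_pos.2 ((annulusCoord_lt_one_iff h0 h).2 h2)
  have c := sq_sub_sq_pos h0 h
  have d := h0.trans h1
  rw [logitSpeed]
  positivity

theorem isOpen_annulus : IsOpen {z : ℂ | rm < ‖z‖ ∧ ‖z‖ < rp} :=
  (isOpen_lt continuous_const continuous_norm).inter (isOpen_lt continuous_norm continuous_const)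

/-- Differentiation along `r ↦ exp (w + r)` keeps the argument fixed. The amplitude `1/2` and the
twist `2` multiply to `1`, so the bracket vanishes at phase `0`; this is what makes phase `0` a
barrier despite the unbounded `logitSpeed`. -/
theorem fderiv_spiralPotential_radial (h0 : 0 < rm) (h : rm < rp) {w : ℂ}
    (h1 : rm < ‖Complex.exp w‖) (h2 : ‖Complex.exp w‖ < rp) :
    fderiv ℝ (spiralPotential rm rp) (Complex.exp w) (Complex.exp w) =
      logitSpeed rm rp (Complex.exp w) *
        (Real.smoothTransition (annulusCoord rm rp (Complex.exp w)) *
          (1 - Real.smoothTransition (annulusCoord rm rp (Complex.exp w)))) *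
        (1 + 1 / 2 * (1 - 2 * Real.smoothTransition (annulusCoord rm rp (Complex.exp w))) *
          Real.sin (w.im - 2 * logit (annulusCoord rm rp (Complex.exp w))) -
          Real.cos (w.im - 2 * logit (annulusCoord rm rp (Complex.exp w)))) := by
  have hF := ((contDiff_spiralPotential h0 h).differentiable (by simp)) (Complex.exp w)
  have hc : HasDerivAt (fun r : ℝ => Complex.exp (w + r)) (Complex.exp w) 0 := by
    have := ((hasDerivAt_id (0 : ℝ)).ofReal_comp.const_add w).cexp
    simpa using this
  have hF' : HasFDerivAt (spiralPotential rm rp) (fderiv ℝ (spiralPotential rm rp) (Complex.exp w))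
      (Complex.exp (w + (0 : ℝ))) := by simpa using hF.hasFDerivAt
  have hd := hF'.comp_hasDerivAt 0 hc
  have hxr : ∀ r : ℝ, annulusCoord rm rp (Complex.exp (w + r)) =
      (Real.exp (2 * (w.re + r)) - rm ^ 2) / (rp ^ 2 - rm ^ 2) := by
    intro r; rw [annulusCoord_exp]; simp
  have hev : (spiralPotential rm rp ∘ fun r : ℝ => Complex.exp (w + r)) =ᶠ[𝓝 0]
      fun r => polarPotential (annulusCoord rm rp (Complex.exp (w + r))) w.im := by
    have := hc.continuousAt.preimage_mem_nhds ((isOpen_annulus (rm := rm) (rp := rp)).mem_nhds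
      (by simpa using ⟨h1, h2⟩))
    filter_upwards [this] with r hr
    have := spiralPotential_exp h0 h hr.1 hr.2
    simpa using this
  have hx : HasDerivAt (fun r : ℝ => annulusCoord rm rp (Complex.exp (w + r)))
      (2 * ‖Complex.exp w‖ ^ 2 / (rp ^ 2 - rm ^ 2)) 0 := by
    simp only [hxr]
    have := (((((hasDerivAt_id (0 : ℝ)).const_add w.re).const_mul 2).exp).sub_const
      (rm ^ 2)).div_const (rp ^ 2 - rm ^ 2)
    refine this.congr_deriv ?_
    rw [Complex.norm_exp, ← Real.exp_nat_mul]
    simp [mul_comm]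
  have p0 := (annulusCoord_pos_iff h0 h).2 h1
  have p1 := (annulusCoord_lt_one_iff h0 h).2 h2
  have hxx : annulusCoord rm rp (Complex.exp (w + (0 : ℝ))) = annulusCoord rm rp (Complex.exp w) := by
    simp
  have hS := (hasDerivAt_smoothTransition p0 p1)
  have hl := (hasDerivAt_logit p0.ne' p1.ne)
  rw [← hxx] at hS hl
  have hS' := hS.comp (0 : ℝ) hx
  have hl' := hl.comp (0 : ℝ) hx
  have hp := hS'.add (((hS'.mul (hS'.const_sub 1)).mul
    ((hl'.const_mul 2).const_sub w.im).sin).const_mul (1 / 2))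
  have := (hd.congr_of_eventuallyEq hev.symm).unique hp
  rw [this]
  simp only [Function.comp, hxx, logitSpeed, Pi.mul_apply]
  ring

/-- Along `r ↦ exp (w + r i)` the modulus is constant, and only the sine varies. -/
theorem fderiv_spiralPotential_angular (h0 : 0 < rm) (h : rm < rp) {w : ℂ}
    (h1 : rm < ‖Complex.exp w‖) (h2 : ‖Complex.exp w‖ < rp) :
    fderiv ℝ (spiralPotential rm rp) (Complex.exp w) (Complex.exp w * Complex.I) =
      1 / 2 * (Real.smoothTransition (annulusCoord rm rp (Complex.exp w)) *
          (1 - Real.smoothTransition (annulusCoord rm rp (Complex.exp w)))) *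
          Real.cos (w.im - 2 * logit (annulusCoord rm rp (Complex.exp w))) := by
  have hF := ((contDiff_spiralPotential h0 h).differentiable (by simp)) (Complex.exp w)
  have hc : HasDerivAt (fun r : ℝ => Complex.exp (w + r * Complex.I))
      (Complex.exp w * Complex.I) 0 := by
    have := (((hasDerivAt_id (0 : ℝ)).ofReal_comp.mul_const Complex.I).const_add w).cexp
    simpa using this
  have hF' : HasFDerivAt (spiralPotential rm rp) (fderiv ℝ (spiralPotential rm rp) (Complex.exp w))
      (Complex.exp (w + (0 : ℝ) * Complex.I)) := by simpa using hF.hasFDerivAt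
  have hd := hF'.comp_hasDerivAt 0 hc
  have hev : (spiralPotential rm rp ∘ fun r : ℝ => Complex.exp (w + r * Complex.I)) =ᶠ[𝓝 0]
      fun r => polarPotential (annulusCoord rm rp (Complex.exp w)) (w.im + r) := by
    have := hc.continuousAt.preimage_mem_nhds ((isOpen_annulus (rm := rm) (rp := rp)).mem_nhds
      (by simpa using ⟨h1, h2⟩))
    filter_upwards [this] with r hr
    have := spiralPotential_exp h0 h hr.1 hr.2
    simpa [annulusCoord_exp] using this
  have hp := ((((((hasDerivAt_id (0 : ℝ)).const_add w.im).sub_const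
    (2 * logit (annulusCoord rm rp (Complex.exp w)))).sin).const_mul
    (Real.smoothTransition (annulusCoord rm rp (Complex.exp w)) *
          (1 - Real.smoothTransition (annulusCoord rm rp (Complex.exp w))))).const_mul
          (1 / 2)).const_add (Real.smoothTransition (annulusCoord rm rp (Complex.exp w)))
  have := (hd.congr_of_eventuallyEq hev.symm).unique hp
  rw [this]
  simp only [id, add_zero]
  ring

/-! ### Global solutions of autonomous equations -/

section ODE

variable {E : Type*} [NormedAddCommGroup E] [NormedSpace ℝ E]

/-- A bounded Lipschitz vector field has global integral curves. -/
theorem exists_hasDerivAt_of_lipschitzWith [CompleteSpace E] {v : E → E} {K L : NNReal} (hv : LipschitzWith K v)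
    (hL : ∀ x, ‖v x‖ ≤ L) (x₀ : E) :
    ∃ z : ℝ → E, z 0 = x₀ ∧ ∀ s, HasDerivAt z (v (z s)) s := by
  have hloc : ∀ N : ℕ, ∃ α : ℝ → E, α 0 = x₀ ∧
      ∀ t ∈ Ioo (-(N : ℝ)) N, HasDerivAt α (v (α t)) t := by
    intro N
    have hN : (0 : ℝ) ∈ Icc (-(N : ℝ)) N := by simp
    -- In time `N` a solution of speed at most `L` moves by at most `L * N`, so a ball of that
    -- radius suffices.
    have hPL : IsPicardLindelof (fun _ => v) (⟨0, hN⟩ : Icc (-(N : ℝ)) N) x₀ (L * N) 0 L K :=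
      IsPicardLindelof.of_time_independent (fun x _ => hL x) hv.lipschitzOnWith (by simp)
    obtain ⟨α, h1, h2⟩ := hPL.exists_eq_forall_mem_Icc_hasDerivWithinAt₀
    exact ⟨α, h1, fun t ht => (h2 t (Ioo_subset_Icc_self ht)).hasDerivAt (Icc_mem_nhds ht.1 ht.2)⟩
  choose α hα0 hα using hloc
  have hagree : ∀ M N : ℕ, 1 ≤ M → M ≤ N → EqOn (α M) (α N) (Ioo (-(M : ℝ)) M) := by
    intro M N h1 hMN
    have h1' : (0 : ℝ) < M := by exact_mod_cast h1
    have hMN' : (M : ℝ) ≤ N := by exact_mod_cast hMN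
    refine ODE_solution_unique_of_mem_Ioo (v := fun _ => v) (s := fun _ => univ) (t₀ := 0)
      (fun t _ => hv.lipschitzOnWith) ⟨by linarith, h1'⟩ (fun t ht => ⟨hα M t ht, trivial⟩)
      (fun t ht => ⟨hα N t ⟨by linarith [ht.1], by linarith [ht.2]⟩, trivial⟩) ?_
    rw [hα0, hα0]
  -- The `+ 1` puts `t` in the open interval of its local solution; near `s` all these solutions
  -- agree with the one of index `⌈|s|⌉₊ + 2`.
  refine ⟨fun t => α (⌈|t|⌉₊ + 1) t, hα0 _, fun s => ?_⟩
  set N := ⌈|s|⌉₊ + 2 with hN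
  have hs : |s| ≤ ⌈|s|⌉₊ := Nat.le_ceil _
  have hev : ∀ t, |t| < |s| + 1 → α (⌈|t|⌉₊ + 1) t = α N t := by
    intro t ht
    refine hagree _ _ (by omega) ?_ (abs_lt.1 ?_)
    · have : ⌈|t|⌉₊ ≤ ⌈|s|⌉₊ + 1 := by
        refine Nat.ceil_le.2 ?_
        push_cast
        linarith
      omega
    · push_cast
      linarith [Nat.le_ceil |t|]
  have hsN : s ∈ Ioo (-(N : ℝ)) N := by
    refine abs_lt.1 ?_
    rw [hN]; push_cast; linarith
  have h := hα N s hsN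
  simp only [hev s (by linarith)]
  refine h.congr_of_eventuallyEq ?_
  have : ∀ᶠ t in 𝓝 s, |t| < |s| + 1 :=
    continuous_abs.continuousAt.eventually_lt_const (by linarith)
  filter_upwards [this] with t ht using hev t ht

/-- Integral curves of smooth vector fields are smooth. -/
theorem contDiff_of_hasDerivAt {v : E → E} (hv : ContDiff ℝ ∞ v) {z : ℝ → E}
    (hz : ∀ s, HasDerivAt z (v (z s)) s) : ContDiff ℝ ∞ z := by
  refine contDiff_infty.2 fun m => ?_
  have hd : Differentiable ℝ z := fun s => (hz s).differentiableAt
  induction m with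
  | zero => exact contDiff_zero.2 hd.continuous
  | succ m ih =>
    rw [show ((m + 1 : ℕ) : WithTop ℕ∞) = m + 1 from rfl]
    refine contDiff_succ_iff_deriv.2 ⟨hd, by simp, ?_⟩
    rw [show deriv z = v ∘ z from funext fun s => (hz s).deriv]
    exact (hv.of_le (by exact_mod_cast le_top)).comp ih

end ODE

/-! ### Barriers -/

theorem le_of_deriv_pos_at_barrier {f f' : ℝ → ℝ} (hf : ∀ s, HasDerivAt f (f' s) s) {c : ℝ}
    (hc : ∀ s, f s = c → 0 < f' s) {a b : ℝ} (ha : c ≤ f a) (hab : a ≤ b) : c ≤ f b :=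
  image_le_of_deriv_right_lt_deriv_boundary (f := fun _ => c) (f' := fun _ => 0) (B := f) (B' := f')
    continuousOn_const (fun x _ => hasDerivWithinAt_const x _ c) ha hf
    (fun x _ hx => hc x hx.symm) ⟨hab, le_rfl⟩

theorem le_barrier_of_deriv_neg {f f' : ℝ → ℝ} (hf : ∀ s, HasDerivAt f (f' s) s) {c : ℝ}
    (hc : ∀ s, f s = c → f' s < 0) {a b : ℝ} (ha : f a ≤ c) (hab : a ≤ b) : f b ≤ c := by
  have := le_of_deriv_pos_at_barrier (f := fun s => -f s) (fun s => (hf s).neg) (c := -c)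
    (fun s hs => neg_pos.2 (hc s (neg_inj.1 hs))) (neg_le_neg ha) hab
  exact neg_le_neg_iff.1 this

/-- The initial value lies between some `c + m p` and some `d + k p`; the first cannot be crossed
downwards, nor the second upwards. -/
theorem exists_bound_of_barriers_forward {f f' : ℝ → ℝ} (hf : ∀ s, HasDerivAt f (f' s) s)
    {c d p : ℝ} (hp : 0 < p) (hup : ∀ s (m : ℤ), f s = c + m * p → 0 < f' s)
    (hdown : ∀ s (m : ℤ), f s = d + m * p → f' s < 0) : ∃ C, ∀ s, 0 ≤ s → |f s| ≤ C := by
  obtain ⟨m, hm⟩ : ∃ m : ℤ, c + m * p ≤ f 0 := by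
    refine ⟨⌊(f 0 - c) / p⌋, ?_⟩
    have := (le_div_iff₀ hp).1 (Int.floor_le ((f 0 - c) / p))
    linarith
  obtain ⟨k, hk⟩ : ∃ k : ℤ, f 0 ≤ d + k * p := by
    refine ⟨⌈(f 0 - d) / p⌉, ?_⟩
    have := (div_le_iff₀ hp).1 (Int.le_ceil ((f 0 - d) / p))
    linarith
  refine ⟨max |c + m * p| |d + k * p|, fun s hs => ?_⟩
  exact abs_le_max_abs_abs (le_of_deriv_pos_at_barrier hf (fun s => hup s m) hm hs)
    (le_barrier_of_deriv_neg hf (fun s => hdown s k) hk hs)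

/-- A function which increases at the values in `c + ℤ p` and decreases at the values in `d + ℤ p`
is bounded. -/
theorem exists_bound_of_barriers {f f' : ℝ → ℝ} (hf : ∀ s, HasDerivAt f (f' s) s)
    {c d p : ℝ} (hp : 0 < p) (hup : ∀ s (m : ℤ), f s = c + m * p → 0 < f' s)
    (hdown : ∀ s (m : ℤ), f s = d + m * p → f' s < 0) : ∃ C, ∀ s, |f s| ≤ C := by
  obtain ⟨C, hC⟩ := exists_bound_of_barriers_forward hf hp hup hdown
  have hf' : ∀ s, HasDerivAt (fun s => f (-s)) (-f' (-s)) s := fun s => by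
    simpa [Function.comp_def] using (hf (-s)).scomp s (hasDerivAt_neg s)
  -- Reversing time exchanges the two kinds of barriers.
  obtain ⟨C', hC'⟩ := exists_bound_of_barriers_forward hf' hp
    (fun s m hs => neg_pos.2 (hdown (-s) m hs)) (fun s m hs => neg_neg_iff_pos.2 (hup (-s) m hs))
  refine ⟨max C C', fun s => ?_⟩
  rcases le_total 0 s with hs | hs
  · exact (hC s hs).trans (le_max_left _ _)
  · simpa using (hC' (-s) (neg_nonneg.2 hs)).trans (le_max_right C C')

/-! ### Gradient lines of the potential -/

section Flow

variable {rm rp : ℝ}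

theorem exists_exp_eq {z : ℂ} (h0 : 0 < rm) (h1 : rm < ‖z‖) : ∃ w, Complex.exp w = z :=
  ⟨Complex.log z, Complex.exp_log (norm_pos_iff.1 (h0.trans h1))⟩

theorem contDiff_gradient {E : Type*} [NormedAddCommGroup E] [InnerProductSpace ℝ E]
    [CompleteSpace E] {f : E → ℝ} (hf : ContDiff ℝ ∞ f) : ContDiff ℝ ∞ (gradient f) :=
  (InnerProductSpace.toDual ℝ E).symm.contDiff.comp (hf.fderiv_right (m := ∞) (by simp))

theorem fderiv_eq_inner_gradient {E : Type*} [NormedAddCommGroup E] [InnerProductSpace ℝ E]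
    [CompleteSpace E] (f : E → ℝ) (x v : E) : fderiv ℝ f x v = inner ℝ (gradient f x) v := by
  simp [gradient]

/-! ### Critical points and extremal values of the potential -/

/-- The potential has no critical points in the open annulus. -/
theorem gradient_spiralPotential_ne_zero (h0 : 0 < rm) (h : rm < rp) {z : ℂ} (h1 : rm < ‖z‖)
    (h2 : ‖z‖ < rp) : gradient (spiralPotential rm rp) z ≠ 0 := by
  intro hz
  obtain ⟨w, rfl⟩ := exists_exp_eq h0 h1
  have hr := fderiv_spiralPotential_radial h0 h h1 h2
  have ha := fderiv_spiralPotential_angular h0 h h1 h2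
  have p0 := (annulusCoord_pos_iff h0 h).2 h1
  have p1 := (annulusCoord_lt_one_iff h0 h).2 h2
  have hk := logitSpeed_pos h0 h h1 h2
  rw [fderiv_eq_inner_gradient, hz, inner_zero_left] at hr ha
  set S := Real.smoothTransition (annulusCoord rm rp (Complex.exp w))
  have s0 : 0 < S := Real.smoothTransition.pos_of_pos p0
  have s1 : S < 1 := Real.smoothTransition.lt_one_of_lt_one p1
  have hSS : S * (1 - S) ≠ 0 := (mul_pos s0 (sub_pos.2 s1)).ne'
  -- The angular derivative forces `cos = 0`. The radial bracket is then `1 + (1/2)(1 - 2S) sin`,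
  -- which is positive because `|1 - 2S| < 1`.
  have hcos := (mul_eq_zero.1 ha.symm).resolve_left (mul_ne_zero (by norm_num) hSS)
  rw [hcos] at hr
  have h3 := (mul_eq_zero.1 hr.symm).resolve_left (mul_ne_zero hk.ne' hSS)
  have := Real.neg_one_le_sin (w.im - 2 * logit (annulusCoord rm rp (Complex.exp w)))
  have := Real.sin_le_one (w.im - 2 * logit (annulusCoord rm rp (Complex.exp w)))
  nlinarith

theorem abs_spiralPotential_sub_le (h0 : 0 < rm) (h : rm < rp) (z : ℂ) :
    |spiralPotential rm rp z - Real.smoothTransition (annulusCoord rm rp z)| ≤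
      1 / 2 * (Real.smoothTransition (annulusCoord rm rp z) *
        (1 - Real.smoothTransition (annulusCoord rm rp z))) := by
  have hS : 0 ≤ Real.smoothTransition (annulusCoord rm rp z) *
      (1 - Real.smoothTransition (annulusCoord rm rp z)) :=
    mul_nonneg (Real.smoothTransition.nonneg _) (sub_nonneg.2 (Real.smoothTransition.le_one _))
  rcases le_or_gt ‖z‖ rm with h1 | h1
  · have hx : annulusCoord rm rp z ≤ 0 := by
      rw [← not_lt, annulusCoord_pos_iff h0 h]; exact h1.not_gt
    simp [spiralPotential_of_norm_le h0 h h1, hx]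
  rcases le_or_gt rp ‖z‖ with h2 | h2
  · have hx : 1 ≤ annulusCoord rm rp z := by
      rw [← not_lt, annulusCoord_lt_one_iff h0 h]; exact h2.not_gt
    simp [spiralPotential_of_le_norm h0 h h2, Real.smoothTransition.one_of_one_le hx]
  obtain ⟨w, rfl⟩ := exists_exp_eq h0 h1
  rw [spiralPotential_exp h0 h h1 h2, polarPotential, add_sub_cancel_left, abs_mul, abs_mul,
    abs_of_nonneg hS, abs_of_nonneg (by norm_num : (0 : ℝ) ≤ 1 / 2)]
  exact mul_le_mul_of_nonneg_left (mul_le_of_le_one_right hS (Real.abs_sin_le_one _))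
    (by norm_num)

/-- The potential is comparable to `S`, so its convergence to `0` along a gradient line forces that
of `annulusCoord`; the next lemma serves the same purpose at `1`. -/
theorem half_smoothTransition_le (h0 : 0 < rm) (h : rm < rp) (z : ℂ) :
    1 / 2 * Real.smoothTransition (annulusCoord rm rp z) ≤ spiralPotential rm rp z ∧
    spiralPotential rm rp z ≤ 2 * Real.smoothTransition (annulusCoord rm rp z) := by
  have := abs_le.1 (abs_spiralPotential_sub_le h0 h z)
  have s0 := Real.smoothTransition.nonneg (annulusCoord rm rp z)
  have s1 := Real.smoothTransition.le_one (annulusCoord rm rp z)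
  constructor <;> nlinarith

theorem half_one_sub_smoothTransition_le (h0 : 0 < rm) (h : rm < rp) (z : ℂ) :
    1 / 2 * (1 - Real.smoothTransition (annulusCoord rm rp z)) ≤ 1 - spiralPotential rm rp z := by
  have := abs_le.1 (abs_spiralPotential_sub_le h0 h z)
  have s0 := Real.smoothTransition.nonneg (annulusCoord rm rp z)
  have s1 := Real.smoothTransition.le_one (annulusCoord rm rp z)
  nlinarith

theorem spiralPotential_nonneg (h0 : 0 < rm) (h : rm < rp) (z : ℂ) :
    0 ≤ spiralPotential rm rp z :=
  le_trans (mul_nonneg (by norm_num) (Real.smoothTransition.nonneg _))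
    (half_smoothTransition_le h0 h z).1

theorem spiralPotential_le_one (h0 : 0 < rm) (h : rm < rp) (z : ℂ) :
    spiralPotential rm rp z ≤ 1 := by
  have := half_one_sub_smoothTransition_le h0 h z
  have := Real.smoothTransition.le_one (annulusCoord rm rp z)
  linarith

/-- Outside the open annulus all points are critical. -/
theorem gradient_spiralPotential_eq_zero (h0 : 0 < rm) (h : rm < rp) {z : ℂ}
    (hz : ‖z‖ ≤ rm ∨ rp ≤ ‖z‖) : gradient (spiralPotential rm rp) z = 0 := by
  have : fderiv ℝ (spiralPotential rm rp) z = 0 := by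
    rcases hz with hz | hz
    · refine IsLocalMin.fderiv_eq_zero (Filter.Eventually.of_forall fun w => ?_)
      rw [spiralPotential_of_norm_le h0 h hz]
      exact spiralPotential_nonneg h0 h w
    · refine IsLocalMax.fderiv_eq_zero (Filter.Eventually.of_forall fun w => ?_)
      rw [spiralPotential_of_le_norm h0 h hz]
      exact spiralPotential_le_one h0 h w
  simp [gradient, this]

theorem exists_lipschitzWith_gradient (h0 : 0 < rm) (h : rm < rp) :
    ∃ K L : NNReal, LipschitzWith K (fun z => Real.pi • gradient (spiralPotential rm rp) z) ∧
      ∀ z, ‖Real.pi • gradient (spiralPotential rm rp) z‖ ≤ L := by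
  have hs : ContDiff ℝ ∞ (fun z => Real.pi • gradient (spiralPotential rm rp) z) :=
    (contDiff_gradient (contDiff_spiralPotential h0 h)).const_smul Real.pi
  have hc : HasCompactSupport (fun z => Real.pi • gradient (spiralPotential rm rp) z) := by
    refine HasCompactSupport.intro (isCompact_closedBall (0 : ℂ) rp) fun z hz => ?_
    rw [mem_closedBall_zero_iff, not_le] at hz
    rw [gradient_spiralPotential_eq_zero h0 h (Or.inr hz.le), smul_zero]
  obtain ⟨K, hK⟩ := hs.lipschitzWith_of_hasCompactSupport hc (by simp)
  obtain ⟨L, hL⟩ := hc.exists_bound_of_continuous hs.continuous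
  exact ⟨K, L.toNNReal, hK, fun z => (hL z).trans (Real.le_coe_toNNReal L)⟩

/-- The gradient is bounded below where the potential is bounded away from its extremal values. -/
theorem exists_lower_bound_gradient (h0 : 0 < rm) (h : rm < rp) {c d : ℝ} (hc : 0 < c)
    (hd : d < 1) : ∃ m > 0, ∀ z, c ≤ spiralPotential rm rp z → spiralPotential rm rp z ≤ d →
      m ≤ ‖gradient (spiralPotential rm rp) z‖ ^ 2 := by
  have hG := (contDiff_spiralPotential h0 h).continuous
  set K : Set ℂ := {z | c ≤ spiralPotential rm rp z ∧ spiralPotential rm rp z ≤ d}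
  have hmem : ∀ z ∈ K, rm < ‖z‖ ∧ ‖z‖ < rp := by
    intro z hz
    constructor
    · by_contra! hle
      have := hz.1
      rw [spiralPotential_of_norm_le h0 h hle] at this
      linarith
    · by_contra! hle
      have := hz.2
      rw [spiralPotential_of_le_norm h0 h hle] at this
      linarith
  have hK : IsCompact K := by
    refine Metric.isCompact_of_isClosed_isBounded ?_ ?_
    · exact (isClosed_le continuous_const hG).inter (isClosed_le hG continuous_const)
    · exact Metric.isBounded_closedBall.subset fun z hz =>
        mem_closedBall_zero_iff.2 (hmem z hz).2.le
  rcases K.eq_empty_or_nonempty with he | hne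
  · exact ⟨1, one_pos, fun z h1 h2 => absurd (show z ∈ K from ⟨h1, h2⟩) (by simp [he])⟩
  · obtain ⟨z₀, hz₀, hmin⟩ := hK.exists_isMinOn hne
      ((contDiff_gradient (contDiff_spiralPotential h0 h)).continuous.norm.pow 2).continuousOn
    refine ⟨_, pow_pos (norm_pos_iff.2 (gradient_spiralPotential_ne_zero h0 h (hmem z₀ hz₀).1
      (hmem z₀ hz₀).2)) 2, fun z h1 h2 => hmin ⟨h1, h2⟩⟩

/-! ### Confinement and limits of gradient lines -/

variable {z : ℝ → ℂ}

/-- Points outside the open annulus are equilibria, so by uniqueness a solution that meets one of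
them is constant. -/
theorem gradientLine_mem_annulus (h0 : 0 < rm) (h : rm < rp)
    (hz : ∀ s, HasDerivAt z (Real.pi • gradient (spiralPotential rm rp) (z s)) s)
    (h1 : rm < ‖z 0‖) (h2 : ‖z 0‖ < rp) (s : ℝ) : rm < ‖z s‖ ∧ ‖z s‖ < rp := by
  by_contra hs
  have hs' : ‖z s‖ ≤ rm ∨ rp ≤ ‖z s‖ := by
    by_contra! hh
    exact hs hh
  obtain ⟨K, L, hK, -⟩ := exists_lipschitzWith_gradient h0 h
  have : z = fun _ => z s := ODE_solution_unique_univ (s := fun _ => univ) (t₀ := s)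
    (v := fun _ z => Real.pi • gradient (spiralPotential rm rp) z)
    (fun _ => hK.lipschitzOnWith) (fun t => ⟨hz t, trivial⟩)
    (fun t => ⟨by
      rw [gradient_spiralPotential_eq_zero h0 h hs', smul_zero]
      exact hasDerivAt_const t (z s), trivial⟩) rfl
  rw [congrFun this 0] at h1 h2
  exact hs ⟨h1, h2⟩

theorem hasDerivAt_comp_gradientLine {G : ℂ → ℝ} (hG : Differentiable ℝ G)
    (hz : ∀ s, HasDerivAt z (Real.pi • gradient G (z s)) s) (s : ℝ) :
    HasDerivAt (fun s => G (z s)) (Real.pi * ‖gradient G (z s)‖ ^ 2) s := by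
  have := (hG (z s)).hasFDerivAt.comp_hasDerivAt s (hz s)
  refine this.congr_deriv ?_
  rw [map_smul, fderiv_eq_inner_gradient, real_inner_self_eq_norm_sq, smul_eq_mul]

theorem monotone_comp_gradientLine {G : ℂ → ℝ} (hG : Differentiable ℝ G)
    (hz : ∀ s, HasDerivAt z (Real.pi • gradient G (z s)) s) : Monotone fun s => G (z s) :=
  monotone_of_deriv_nonneg (fun s => (hasDerivAt_comp_gradientLine hG hz s).differentiableAt)
    fun s => by
      rw [(hasDerivAt_comp_gradientLine hG hz s).deriv]
      have := Real.pi_pos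
      positivity

/-- The potential is monotone along the line. If it stayed away from `1` in the future, or from `0`
in the past, its rate of growth would be bounded below by compactness, and its total variation would
exceed `1`. -/
theorem tendsto_potential_gradientLine (h0 : 0 < rm) (h : rm < rp)
    (hz : ∀ s, HasDerivAt z (Real.pi • gradient (spiralPotential rm rp) (z s)) s)
    (h1 : rm < ‖z 0‖) (h2 : ‖z 0‖ < rp) :
    Tendsto (fun s => spiralPotential rm rp (z s)) atTop (𝓝 1) ∧
      Tendsto (fun s => spiralPotential rm rp (z s)) atBot (𝓝 0) := by
  have hGd : Differentiable ℝ (spiralPotential rm rp) :=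
    (contDiff_spiralPotential h0 h).differentiable (by simp)
  have hmono := monotone_comp_gradientLine hGd hz
  have hder := hasDerivAt_comp_gradientLine hGd hz
  have hpi := Real.pi_pos
  have hx0 := Real.smoothTransition.pos_of_pos ((annulusCoord_pos_iff h0 h).2 h1)
  have hx1 := Real.smoothTransition.lt_one_of_lt_one ((annulusCoord_lt_one_iff h0 h).2 h2)
  have hG0 : 0 < spiralPotential rm rp (z 0) := by
    have := (half_smoothTransition_le h0 h (z 0)).1
    linarith
  have hG1 : spiralPotential rm rp (z 0) < 1 := by
    have := half_one_sub_smoothTransition_le h0 h (z 0)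
    linarith
  have growth : ∀ {m : ℝ}, 0 < m → ∀ a b, a ≤ b →
      (∀ s ∈ Icc a b, m ≤ ‖gradient (spiralPotential rm rp) (z s)‖ ^ 2) →
      Real.pi * m * (b - a) ≤ 1 := by
    intro m hm a b hab hs
    have := (convex_Icc a b).mul_sub_le_image_sub_of_le_deriv
      (f := fun s => spiralPotential rm rp (z s)) (C := Real.pi * m)
      (fun s _ => (hder s).continuousAt.continuousWithinAt)
      (fun s _ => (hder s).differentiableAt.differentiableWithinAt)
      (fun s hs' => by
        rw [(hder s).deriv]
        exact mul_le_mul_of_nonneg_left (hs s (interior_subset hs')) hpi.le) a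
      (left_mem_Icc.2 hab) b (right_mem_Icc.2 hab) hab
    linarith [spiralPotential_le_one h0 h (z b), spiralPotential_nonneg h0 h (z a)]
  constructor
  · rw [tendsto_order]
    refine ⟨fun c hc => ?_, fun c hc => Eventually.of_forall fun s =>
      (spiralPotential_le_one h0 h (z s)).trans_lt hc⟩
    obtain ⟨s₁, hs₁⟩ : ∃ s, c < spiralPotential rm rp (z s) := by
      by_contra! hall
      obtain ⟨m, hm, hbd⟩ := exists_lower_bound_gradient h0 h hG0 hc
      -- During this time the potential would grow by at least `2`.
      have := growth hm 0 (2 / (Real.pi * m)) (by positivity)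
        (fun s hs => hbd _ (hmono hs.1) (hall s))
      rw [sub_zero, mul_div_cancel₀ _ (by positivity)] at this
      linarith
    filter_upwards [eventually_ge_atTop s₁] with s hs using hs₁.trans_le (hmono hs)
  · rw [tendsto_order]
    refine ⟨fun c hc => Eventually.of_forall fun s =>
      hc.trans_le (spiralPotential_nonneg h0 h (z s)), fun c hc => ?_⟩
    obtain ⟨s₁, hs₁⟩ : ∃ s, spiralPotential rm rp (z s) < c := by
      by_contra! hall
      obtain ⟨m, hm, hbd⟩ := exists_lower_bound_gradient h0 h hc hG1
      have := growth hm (-(2 / (Real.pi * m))) 0 (by simp; positivity)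
        (fun s hs => hbd _ (hall s) (hmono hs.2))
      rw [zero_sub, neg_neg, mul_div_cancel₀ _ (by positivity)] at this
      linarith
    filter_upwards [eventually_le_atBot s₁] with s hs using (hmono hs).trans_lt hs₁

theorem tendsto_annulusCoord_gradientLine (h0 : 0 < rm) (h : rm < rp)
    (hz : ∀ s, HasDerivAt z (Real.pi • gradient (spiralPotential rm rp) (z s)) s)
    (h1 : rm < ‖z 0‖) (h2 : ‖z 0‖ < rp) :
    Tendsto (fun s => annulusCoord rm rp (z s)) atTop (𝓝[<] 1) ∧
      Tendsto (fun s => annulusCoord rm rp (z s)) atBot (𝓝[>] 0) := by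
  obtain ⟨ht, hb⟩ := tendsto_potential_gradientLine h0 h hz h1 h2
  have hmem := gradientLine_mem_annulus h0 h hz h1 h2
  have hlt : ∀ s, annulusCoord rm rp (z s) < 1 := fun s =>
    (annulusCoord_lt_one_iff h0 h).2 (hmem s).2
  have hgt : ∀ s, 0 < annulusCoord rm rp (z s) := fun s =>
    (annulusCoord_pos_iff h0 h).2 (hmem s).1
  constructor
  · refine tendsto_nhdsWithin_iff.2 ⟨?_, Eventually.of_forall hlt⟩
    rw [tendsto_order]
    refine ⟨fun c hc => ?_, fun c hc => Eventually.of_forall fun s => (hlt s).trans hc⟩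
    have hSc := Real.smoothTransition.lt_one_of_lt_one hc
    filter_upwards [ht.eventually_const_lt
      (show 1 - 1 / 2 * (1 - Real.smoothTransition c) < 1 by linarith)] with s hs
    by_contra! hle
    have := Real.smoothTransition.monotone hle
    have := half_one_sub_smoothTransition_le h0 h (z s)
    linarith
  · refine tendsto_nhdsWithin_iff.2 ⟨?_, Eventually.of_forall hgt⟩
    rw [tendsto_order]
    refine ⟨fun c hc => Eventually.of_forall fun s => hc.trans (hgt s), fun c hc => ?_⟩
    have hSc := Real.smoothTransition.pos_of_pos hc
    filter_upwards [hb.eventually_lt_const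
      (show 0 < 1 / 2 * Real.smoothTransition c by linarith)] with s hs
    by_contra! hle
    have := Real.smoothTransition.monotone hle
    have := (half_smoothTransition_le h0 h (z s)).1
    linarith

theorem tendsto_logit_one : Tendsto logit (𝓝[<] 1) atTop := by
  have h1 : Tendsto (fun x : ℝ => (1 - x)⁻¹) (𝓝[<] 1) atTop := by
    refine tendsto_inv_nhdsGT_zero.comp (tendsto_nhdsWithin_iff.2 ⟨?_, ?_⟩)
    · exact ((continuous_const.sub continuous_id).tendsto' (1 : ℝ) 0 (by simp)).mono_left
        nhdsWithin_le_nhds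
    · filter_upwards [self_mem_nhdsWithin] with x hx using sub_pos.2 (mem_Iio.1 hx)
  have h2 : Tendsto (fun x : ℝ => -x⁻¹) (𝓝[<] 1) (𝓝 (-1)) := by
    have : ContinuousAt (fun x : ℝ => -x⁻¹) 1 := (continuousAt_inv₀ one_ne_zero).neg
    simpa using this.tendsto.mono_left nhdsWithin_le_nhds
  exact (h1.atTop_add h2).congr fun x => (sub_eq_add_neg _ _).symm

theorem logit_one_sub (x : ℝ) : logit (1 - x) = -logit x := by simp [logit]

theorem tendsto_logit_zero : Tendsto logit (𝓝[>] 0) atBot := by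
  have : Tendsto (fun x : ℝ => 1 - x) (𝓝[>] 0) (𝓝[<] 1) := by
    refine tendsto_nhdsWithin_iff.2 ⟨?_, ?_⟩
    · exact ((continuous_const.sub continuous_id).tendsto' (0 : ℝ) 1 (by simp)).mono_left
        nhdsWithin_le_nhds
    · filter_upwards [self_mem_nhdsWithin] with x hx
      have : (0 : ℝ) < x := hx
      simpa using this
  have h := tendsto_logit_one.comp this
  rw [← tendsto_neg_atTop_iff]
  exact h.congr fun x => logit_one_sub x

theorem norm_eq_sqrt_annulusCoord (h0 : 0 < rm) (h : rm < rp) (z : ℂ) :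
    ‖z‖ = √(rm ^ 2 + annulusCoord rm rp z * (rp ^ 2 - rm ^ 2)) := by
  rw [annulusCoord, div_mul_cancel₀ _ (sq_sub_sq_pos h0 h).ne', add_sub_cancel,
    Real.sqrt_sq (norm_nonneg z)]

theorem tendsto_norm_gradientLine (h0 : 0 < rm) (h : rm < rp)
    (hz : ∀ s, HasDerivAt z (Real.pi • gradient (spiralPotential rm rp) (z s)) s)
    (h1 : rm < ‖z 0‖) (h2 : ‖z 0‖ < rp) :
    Tendsto (fun s => ‖z s‖) atTop (𝓝 rp) ∧ Tendsto (fun s => ‖z s‖) atBot (𝓝 rm) := by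
  obtain ⟨ht, hb⟩ := tendsto_annulusCoord_gradientLine h0 h hz h1 h2
  have hc : Continuous fun x : ℝ => √(rm ^ 2 + x * (rp ^ 2 - rm ^ 2)) := by fun_prop
  simp only [norm_eq_sqrt_annulusCoord h0 h]
  constructor
  · refine (hc.tendsto' 1 rp ?_).comp (tendsto_nhdsWithin_iff.1 ht).1
    rw [one_mul, add_sub_cancel, Real.sqrt_sq (h0.trans h).le]
  · refine (hc.tendsto' 0 rm ?_).comp (tendsto_nhdsWithin_iff.1 hb).1
    rw [zero_mul, add_zero, Real.sqrt_sq h0.le]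

/-! ### Winding of gradient lines -/

/-- Nonvanishing differentiable curves in the plane have a logarithm. -/
theorem exists_log_curve {z z' : ℝ → ℂ} (hz : ∀ s, HasDerivAt z (z' s) s) (hc : Continuous z')
    (hne : ∀ s, z s ≠ 0) :
    ∃ w : ℝ → ℂ, (∀ s, HasDerivAt w (z' s / z s) s) ∧ ∀ s, Complex.exp (w s) = z s := by
  have hzc : Continuous z := continuous_iff_continuousAt.2 fun s => (hz s).continuousAt
  have hq : Continuous fun s => z' s / z s := hc.div hzc hne
  set w : ℝ → ℂ := fun s => Complex.log (z 0) + ∫ r in (0 : ℝ)..s, z' r / z r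
  have hw : ∀ s, HasDerivAt w (z' s / z s) s := fun s =>
    (intervalIntegral.integral_hasDerivAt_right (hq.intervalIntegrable _ _)
      (hq.stronglyMeasurableAtFilter _ _) hq.continuousAt).const_add _
  refine ⟨w, hw, fun s => ?_⟩
  have hd : ∀ r, HasDerivAt (fun s => z s * Complex.exp (-w s)) 0 r := fun r => by
    refine ((hz r).mul (hw r).neg.cexp).congr_deriv ?_
    have := hne r
    simp only [Pi.neg_apply]
    field_simp
    ring
  have hconst := is_const_of_deriv_eq_zero (fun r => (hd r).differentiableAt)
    (fun r => (hd r).deriv) s 0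
  have hw0 : w 0 = Complex.log (z 0) := by simp [w]
  simp only [hw0, Complex.exp_neg, Complex.exp_log (hne 0), mul_inv_cancel₀ (hne 0)] at hconst
  have := Complex.exp_ne_zero (w s)
  field_simp at hconst
  exact hconst.symm

/-- By the intermediate value theorem on `[j, ∞)`, the angle takes a value `arg ζ + 2πm` after every
time `j`; at these times only the modulus still has to converge. -/
theorem exists_seq_tendsto_of_winding {φ : ℝ → ℝ} {r : ℝ} (hφ : Continuous φ)
    (hφt : Tendsto φ atTop atTop) (hz : ∀ s, z s = ‖z s‖ * Complex.exp (φ s * Complex.I))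
    (hr : Tendsto (fun s => ‖z s‖) atTop (𝓝 r)) {ζ : ℂ} (hζ : ‖ζ‖ = r) :
    ∃ σ : ℕ → ℝ, Tendsto σ atTop atTop ∧ Tendsto (fun j => z (σ j)) atTop (𝓝 ζ) := by
  have hex : ∀ j : ℕ, ∃ s : ℝ, (j : ℝ) ≤ s ∧
      Complex.exp (φ s * Complex.I) = Complex.exp (ζ.arg * Complex.I) := by
    intro j
    obtain ⟨m, hm⟩ := exists_nat_ge ((φ j - ζ.arg) / (2 * Real.pi))
    rw [div_le_iff₀ Real.two_pi_pos] at hm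
    obtain ⟨s, hs, hs'⟩ := isPreconnected_Ici.intermediate_value_Ici (a := (j : ℝ)) (l := atTop)
      (mem_Ici.2 le_rfl) (le_principal_iff.2 (Ici_mem_atTop _)) hφ.continuousOn hφt
      (mem_Ici.2 (show φ j ≤ ζ.arg + m * (2 * Real.pi) by linarith))
    refine ⟨s, hs, ?_⟩
    rw [hs']
    refine Complex.exp_eq_exp_iff_exists_int.2 ⟨m, ?_⟩
    push_cast
    ring
  choose σ hσ hσ' using hex
  have hσt : Tendsto σ atTop atTop := tendsto_atTop_mono hσ tendsto_natCast_atTop_atTop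
  refine ⟨σ, hσt, ?_⟩
  have : Tendsto (fun j => ((‖z (σ j)‖ : ℝ) : ℂ) * Complex.exp (ζ.arg * Complex.I)) atTop
      (𝓝 ((r : ℂ) * Complex.exp (ζ.arg * Complex.I))) :=
    ((Complex.continuous_ofReal.tendsto r).comp (hr.comp hσt)).mul_const _
  rw [← hζ, Complex.norm_mul_exp_arg_mul_I] at this
  refine this.congr fun j => ?_
  rw [hz (σ j), ← hσ' j]
  simp [Complex.norm_exp]

/-- A continuous choice of the argument along a gradient line in the annulus tends to `∞` at `∞`
and to `-∞` at `-∞`. -/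
theorem exists_arg_gradientLine (h0 : 0 < rm) (h : rm < rp)
    (hz : ∀ s, HasDerivAt z (Real.pi • gradient (spiralPotential rm rp) (z s)) s)
    (h1 : rm < ‖z 0‖) (h2 : ‖z 0‖ < rp) :
    ∃ φ : ℝ → ℝ, Continuous φ ∧ (∀ s, z s = ‖z s‖ * Complex.exp (φ s * Complex.I)) ∧
      Tendsto φ atTop atTop ∧ Tendsto φ atBot atBot := by
  have hmem := gradientLine_mem_annulus h0 h hz h1 h2
  have hzc : Continuous z := continuous_iff_continuousAt.2 fun s => (hz s).continuousAt
  have hgc := (contDiff_gradient (contDiff_spiralPotential h0 h)).continuous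
  have hne : ∀ s, z s ≠ 0 := fun s => norm_pos_iff.1 (h0.trans (hmem s).1)
  obtain ⟨w, hw, hwz⟩ := exists_log_curve hz ((hgc.comp hzc).const_smul Real.pi) hne
  have hpi := Real.pi_pos
  have him : ∀ s, HasDerivAt (fun s => (w s).im) (Real.pi / ‖z s‖ ^ 2 *
      fderiv ℝ (spiralPotential rm rp) (z s) (z s * Complex.I)) s := by
    intro s
    refine (Complex.imCLM.hasFDerivAt.comp_hasDerivAt s (hw s)).congr_deriv ?_
    rw [fderiv_eq_inner_gradient, Complex.inner, Complex.imCLM_apply, Complex.sq_norm]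
    simp [Complex.div_im]
    ring
  have hxd : ∀ s, HasDerivAt (fun s => annulusCoord rm rp (z s)) (2 * Real.pi *
      fderiv ℝ (spiralPotential rm rp) (z s) (z s) / (rp ^ 2 - rm ^ 2)) s := by
    intro s
    refine (((hz s).norm_sq.sub_const (rm ^ 2)).div_const (rp ^ 2 - rm ^ 2)).congr_deriv ?_
    rw [fderiv_eq_inner_gradient, real_inner_comm, inner_smul_left]
    simp
    ring
  -- The phase of the sine in the potential, with the argument lifted continuously along the line.
  set ψ : ℝ → ℝ := fun s => (w s).im - 2 * logit (annulusCoord rm rp (z s))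
  have hψ : ∀ s, HasDerivAt ψ (Real.pi / ‖z s‖ ^ 2 *
      (fderiv ℝ (spiralPotential rm rp) (z s) (z s * Complex.I) -
        2 * logitSpeed rm rp (z s) * fderiv ℝ (spiralPotential rm rp) (z s) (z s))) s := by
    intro s
    have p0 := (annulusCoord_pos_iff h0 h).2 (hmem s).1
    have p1 := (annulusCoord_lt_one_iff h0 h).2 (hmem s).2
    refine ((him s).sub (((hasDerivAt_logit p0.ne' p1.ne).comp s (hxd s)).const_mul 2)).congr_deriv
      ?_
    have := norm_pos_iff.2 (hne s)
    have := sq_sub_sq_pos h0 h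
    rw [logitSpeed]
    field_simp
  have hS : ∀ s, 0 < Real.smoothTransition (annulusCoord rm rp (z s)) *
      (1 - Real.smoothTransition (annulusCoord rm rp (z s))) := fun s =>
    mul_pos (Real.smoothTransition.pos_of_pos ((annulusCoord_pos_iff h0 h).2 (hmem s).1))
      (sub_pos.2 (Real.smoothTransition.lt_one_of_lt_one
        ((annulusCoord_lt_one_iff h0 h).2 (hmem s).2)))
  have hk : ∀ s, 0 < logitSpeed rm rp (z s) := fun s => logitSpeed_pos h0 h (hmem s).1 (hmem s).2
  have hrad : ∀ s, fderiv ℝ (spiralPotential rm rp) (z s) (z s) = logitSpeed rm rp (z s) *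
      (Real.smoothTransition (annulusCoord rm rp (z s)) *
        (1 - Real.smoothTransition (annulusCoord rm rp (z s)))) *
      (1 + 1 / 2 * (1 - 2 * Real.smoothTransition (annulusCoord rm rp (z s))) * Real.sin (ψ s) -
        Real.cos (ψ s)) := fun s => by
    have := fderiv_spiralPotential_radial h0 h (w := w s) (by rw [hwz]; exact (hmem s).1)
      (by rw [hwz]; exact (hmem s).2)
    rwa [hwz] at this
  have hang : ∀ s, fderiv ℝ (spiralPotential rm rp) (z s) (z s * Complex.I) = 1 / 2 *
      (Real.smoothTransition (annulusCoord rm rp (z s)) *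
        (1 - Real.smoothTransition (annulusCoord rm rp (z s)))) * Real.cos (ψ s) := fun s => by
    have := fderiv_spiralPotential_angular h0 h (w := w s) (by rw [hwz]; exact (hmem s).1)
      (by rw [hwz]; exact (hmem s).2)
    rwa [hwz] at this
  -- At phase `0` the radial derivative vanishes and the angular one is positive. At phase `π` the
  -- angular derivative is negative and the radial one positive, and both lower the phase.
  obtain ⟨C, hC⟩ := exists_bound_of_barriers hψ (c := 0) (d := Real.pi) Real.two_pi_pos
    (fun s m hs => by
      have hcos : Real.cos (ψ s) = 1 := by rw [hs, zero_add, Real.cos_int_mul_two_pi]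
      have hsin : Real.sin (ψ s) = 0 := by
        rw [hs, zero_add]
        simpa using Real.sin_add_int_mul_two_pi 0 m
      rw [hrad, hang, hcos, hsin]
      have := hS s
      have := norm_pos_iff.2 (hne s)
      refine mul_pos (by positivity) ?_
      linarith)
    (fun s m hs => by
      have hcos : Real.cos (ψ s) = -1 := by rw [hs, Real.cos_add_int_mul_two_pi, Real.cos_pi]
      have hsin : Real.sin (ψ s) = 0 := by rw [hs, Real.sin_add_int_mul_two_pi, Real.sin_pi]
      rw [hrad, hang, hcos, hsin]
      have h3 := hS s
      have := norm_pos_iff.2 (hne s)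
      refine mul_neg_of_pos_of_neg (by positivity) ?_
      have := mul_pos (mul_pos (hk s) (hk s)) h3
      nlinarith)
  obtain ⟨ht, hb⟩ := tendsto_annulusCoord_gradientLine h0 h hz h1 h2
  refine ⟨fun s => (w s).im, continuous_iff_continuousAt.2 fun s => (him s).continuousAt,
    fun s => ?_, ?_, ?_⟩
  · rw [← hwz s, Complex.norm_exp, Complex.ofReal_exp, ← Complex.exp_add, Complex.re_add_im]
  · refine tendsto_atTop_mono (f := fun s => -C + 2 * logit (annulusCoord rm rp (z s)))
      (fun s => ?_)
      (tendsto_atTop_add_const_left _ _ ((tendsto_logit_one.comp ht).const_mul_atTop two_pos))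
    have := (abs_le.1 (hC s)).1
    simp only [ψ] at this
    linarith
  · refine tendsto_atBot_mono (f := fun s => C + 2 * logit (annulusCoord rm rp (z s)))
      (fun s => ?_)
      (tendsto_atBot_add_const_left _ _ ((tendsto_logit_zero.comp hb).const_mul_atBot two_pos))
    have := (abs_le.1 (hC s)).2
    simp only [ψ] at this
    linarith

end Flow

/-- There is a smooth function on the plane with values in `[0, 1]` whose gradient lines in the
annulus `rm < ‖z‖ < rp` accumulate at all points of the two boundary circles, which are critical. -/
theorem exists_spiralling_potential {rm rp : ℝ} (h0 : 0 < rm) (h : rm < rp) :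
    ∃ G : ℂ → ℝ, ContDiff ℝ ∞ G ∧ (∀ z, 0 ≤ G z) ∧ (∀ z, G z ≤ 1) ∧
      (∀ z, ‖z‖ = rm ∨ ‖z‖ = rp → gradient G z = 0) ∧
      ∀ z₀, rm < ‖z₀‖ → ‖z₀‖ < rp → ∃ z : ℝ → ℂ, z 0 = z₀ ∧
        (∀ s, HasDerivAt z (Real.pi • gradient G (z s)) s) ∧
        Tendsto (fun s => ‖z s‖) atTop (𝓝 rp) ∧ Tendsto (fun s => ‖z s‖) atBot (𝓝 rm) ∧
        (∀ ζ, ‖ζ‖ = rp → ∃ σ : ℕ → ℝ, Tendsto σ atTop atTop ∧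
          Tendsto (fun j => z (σ j)) atTop (𝓝 ζ)) ∧
        (∀ ζ, ‖ζ‖ = rm → ∃ σ : ℕ → ℝ, Tendsto σ atTop atBot ∧
          Tendsto (fun j => z (σ j)) atTop (𝓝 ζ)) := by
  refine ⟨spiralPotential rm rp, contDiff_spiralPotential h0 h, spiralPotential_nonneg h0 h,
    spiralPotential_le_one h0 h, fun z hz => gradient_spiralPotential_eq_zero h0 h
      (hz.imp (fun e => e.le) fun e => e.ge), fun z₀ h1 h2 => ?_⟩
  obtain ⟨K, L, hK, hL⟩ := exists_lipschitzWith_gradient h0 h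
  obtain ⟨z, rfl, hz⟩ := exists_hasDerivAt_of_lipschitzWith hK hL z₀
  obtain ⟨ht, hb⟩ := tendsto_norm_gradientLine h0 h hz h1 h2
  obtain ⟨φ, hφ, hpolar, hφt, hφb⟩ := exists_arg_gradientLine h0 h hz h1 h2
  refine ⟨z, rfl, hz, ht, hb, fun ζ hζ => exists_seq_tendsto_of_winding hφ hφt hpolar ht hζ,
    fun ζ hζ => ?_⟩
  -- The past is reduced to the future by reversing time. Conjugation turns the angle `φ(-s)`, which
  -- tends to `-∞`, into one which tends to `∞`.
  obtain ⟨σ, hσ, hlim⟩ := exists_seq_tendsto_of_winding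
    (z := fun s => starRingEnd ℂ (z (-s))) (φ := fun s => -φ (-s)) (r := rm)
    (ζ := starRingEnd ℂ ζ) (hφ.comp continuous_neg).neg
    (tendsto_neg_atBot_atTop.comp (hφb.comp tendsto_neg_atTop_atBot))
    (fun s => by
      conv_lhs => rw [hpolar (-s)]
      simp [← Complex.exp_conj])
    (by simpa [Function.comp_def] using hb.comp tendsto_neg_atTop_atBot) (by simpa using hζ)
  refine ⟨fun j => -σ j, tendsto_neg_atTop_atBot.comp hσ, ?_⟩
  simpa [Function.comp_def] using (Complex.continuous_conj.tendsto _).comp hlim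

/-! ### Maps that do not depend on the angle -/

section Snd

variable {n : ℕ} {E : Type*} [NormedAddCommGroup E] [NormedSpace ℝ E]

theorem smoothAt_comp_snd {g : (Fin n → ℂ) → E} (hg : ContDiff ℝ ∞ g) (m : Model n) :
    SmoothAt Model.exp id (fun m => g m.2) m := by
  have : ContDiff ℝ ∞ fun x : TModel n => g (m.2 + x.2) - g m.2 :=
    (hg.comp (contDiff_const.add contDiff_snd)).sub contDiff_const
  exact this.contDiffAt

theorem differential_comp_snd {g : (Fin n → ℂ) → E} {m : Model n} {g' : (Fin n → ℂ) →L[ℝ] E}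
    (hg : HasFDerivAt g g' m.2) :
    differential Model.exp id (fun m => g m.2) m =
      g'.comp (ContinuousLinearMap.snd ℝ ℝ (Fin n → ℂ)) := by
  have h1 : HasFDerivAt (fun x : TModel n => m.2 + x.2)
      (ContinuousLinearMap.snd ℝ ℝ (Fin n → ℂ)) 0 := hasFDerivAt_snd.const_add m.2
  have hg0 : HasFDerivAt g g' (m.2 + (0 : TModel n).2) := by simpa using hg
  exact ((hg0.comp (0 : TModel n) h1).sub_const (g m.2)).fderiv

end Snd

/-! ### The standard contact form and its complex structure -/

section Contact

variable {n : ℕ}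

/-- The part of `λ₀` which depends on the base point. -/
def lamLin (n : ℕ) : (Fin n → ℂ) →L[ℝ] TModel n →L[ℝ] ℝ :=
  ∑ i : Fin n,
    ((Complex.reCLM.comp (ContinuousLinearMap.proj (R := ℝ) (φ := fun _ : Fin n => ℂ) i)).smulRight
        (dy i) -
      (Complex.imCLM.comp (ContinuousLinearMap.proj (R := ℝ) (φ := fun _ : Fin n => ℂ) i)).smulRight
        (dx i))

theorem lamLin_apply (q : Fin n → ℂ) (v : TModel n) :
    lamLin n q v = ∑ i, ((q i).re * (v.2 i).im - (q i).im * (v.2 i).re) := by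
  simp [lamLin, dx, dy]

theorem lam0_eq (m : Model n) :
    lam0 n m = ContinuousLinearMap.fst ℝ ℝ (Fin n → ℂ) + lamLin n m.2 := by
  simp [lam0, lamLin]

theorem lam0_apply (m : Model n) (v : TModel n) :
    lam0 n m v = v.1 + ∑ i, ((m.2 i).re * (v.2 i).im - (m.2 i).im * (v.2 i).re) := by
  rw [lam0_eq, add_apply, lamLin_apply]
  rfl

theorem dlam_lam0 (m : Model n) (v w : TModel n) :
    dlam (lam0 n) m v w = 2 * ∑ i, ((v.2 i).re * (w.2 i).im - (v.2 i).im * (w.2 i).re) := by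
  have h : HasFDerivAt (fun q => ContinuousLinearMap.fst ℝ ℝ (Fin n → ℂ) + lamLin n q)
      (lamLin n) m.2 := (lamLin n).hasFDerivAt.const_add _
  have e : lam0 n = fun m : Model n => ContinuousLinearMap.fst ℝ ℝ (Fin n → ℂ) + lamLin n m.2 :=
    funext lam0_eq
  rw [dlam, extd, e, differential_comp_snd h]
  simp only [ContinuousLinearMap.comp_apply, ContinuousLinearMap.coe_snd', lamLin_apply]
  rw [Finset.mul_sum, ← Finset.sum_sub_distrib]
  exact Finset.sum_congr rfl fun i _ => by ring

/-- Multiplication by `i` on the `ℝ²ⁿ`-component of a tangent vector. -/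
def rotL (n : ℕ) : TModel n →L[ℝ] TModel n :=
  (ContinuousLinearMap.inr ℝ ℝ (Fin n → ℂ)).comp
    (((Complex.I • ContinuousLinearMap.id ℂ (Fin n → ℂ)).restrictScalars ℝ).comp
      (ContinuousLinearMap.snd ℝ ℝ (Fin n → ℂ)))

theorem rotL_apply (v : TModel n) : rotL n v = (0, Complex.I • v.2) := by
  simp [rotL]

/-- The lift to `ξ₀` of the standard complex structure of `ℝ²ⁿ`. -/
def stdJ (n : ℕ) (m : Model n) : TModel n →L[ℝ] TModel n :=
  rotL n - ((lamLin n m.2).comp (rotL n)).smulRight (1, 0)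

theorem stdJ_apply (m : Model n) (v : TModel n) :
    stdJ n m v = (-lamLin n m.2 (0, Complex.I • v.2), Complex.I • v.2) := by
  simp [stdJ, rotL_apply]

/-- The projection `ξ₀ → ℂⁿ` is an isomorphism at each point, and `dλ₀` is the pullback of twice the
standard symplectic form, with which multiplication by `i` is compatible. -/
theorem isCompatible_stdJ (n : ℕ) : IsCompatible (lam0 n) (stdJ n) where
  smooth m := by
    refine smoothAt_comp_snd (g := fun q => rotL n - ((lamLin n q).comp (rotL n)).smulRight (1, 0))
      ?_ m
    exact contDiff_const.sub
      (((lamLin n).contDiff.clm_comp contDiff_const).smulRight contDiff_const)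
  mapsTo m v _ := by
    rw [stdJ_apply, lam0_eq]
    simp [lamLin_apply]
  sq m v hv := by
    rw [stdJ_apply, stdJ_apply]
    rw [lam0_apply] at hv
    refine Prod.ext ?_ ?_
    · simp only [smul_smul, Complex.I_mul_I, lamLin_apply, Prod.fst_neg]
      rw [eq_neg_of_add_eq_zero_left hv, neg_inj, ← Finset.sum_neg_distrib]
      exact Finset.sum_congr rfl fun i _ => by simp; ring
    · simp [smul_smul]
  symm m v w _ _ := by
    rw [dlam_lam0, dlam_lam0, stdJ_apply, stdJ_apply]
    congr 1
    exact Finset.sum_congr rfl fun i _ => by simp; ring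
  pos m v hv hne := by
    rw [lam0_apply] at hv
    rw [dlam_lam0, stdJ_apply]
    have hv2 : v.2 ≠ 0 := fun h => by
      rw [h] at hv
      exact hne (Prod.ext (by simpa using hv) h)
    obtain ⟨i, hi⟩ := Function.ne_iff.1 hv2
    have hterm : ∀ i, (v.2 i).re * ((Complex.I • v.2) i).im - (v.2 i).im * ((Complex.I • v.2) i).re =
        Complex.normSq (v.2 i) := fun i => by simp [Complex.normSq_apply]
    simp only [hterm]
    refine mul_pos two_pos (Finset.sum_pos' (fun i _ => Complex.normSq_nonneg _)
      ⟨i, Finset.mem_univ i, Complex.normSq_pos.2 hi⟩)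

end Contact

/-! ### Conformal factors depending on the last coordinate -/

section Conformal

variable {n : ℕ} {G : ℂ → ℝ}

/-- The conformal factor on `S¹ × ℝ²ⁿ` given by a function of the last coordinate. -/
def lastFactor (n : ℕ) (G : ℂ → ℝ) (m : Model (n + 1)) : ℝ := G (m.2 (Fin.last n))

theorem smoothAt_lastFactor (hG : ContDiff ℝ ∞ G) (m : Model (n + 1)) :
    SmoothAt Model.exp id (lastFactor n G) m :=
  smoothAt_comp_snd (g := fun q : Fin (n + 1) → ℂ => G (q (Fin.last n)))
    (hG.comp (contDiff_apply ℝ ℂ (Fin.last n))) m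

theorem conformal_apply (m : Model (n + 1)) (v : TModel (n + 1)) :
    conformal (lastFactor n G) (lam0 (n + 1)) m v =
      Real.exp (G (m.2 (Fin.last n))) * lam0 (n + 1) m v := rfl

/-- Leibniz rule: `d(e^G λ₀) = e^G (dλ₀ + dG ∧ λ₀)`. -/
theorem dlam_conformal (hG : ContDiff ℝ ∞ G) (m : Model (n + 1)) (v w : TModel (n + 1)) :
    dlam (conformal (lastFactor n G) (lam0 (n + 1))) m v w =
      Real.exp (G (m.2 (Fin.last n))) *
        (dlam (lam0 (n + 1)) m v w +
          inner ℝ (gradient G (m.2 (Fin.last n))) (v.2 (Fin.last n)) * lam0 (n + 1) m w -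
          inner ℝ (gradient G (m.2 (Fin.last n))) (w.2 (Fin.last n)) * lam0 (n + 1) m v) := by
  have h1 : HasFDerivAt (fun q => ContinuousLinearMap.fst ℝ ℝ (Fin (n + 1) → ℂ) + lamLin (n + 1) q)
      (lamLin (n + 1)) m.2 := (lamLin (n + 1)).hasFDerivAt.const_add _
  have h2 : HasFDerivAt (fun q : Fin (n + 1) → ℂ => G (q (Fin.last n)))
      ((fderiv ℝ G (m.2 (Fin.last n))).comp
        (ContinuousLinearMap.proj (R := ℝ) (φ := fun _ : Fin (n + 1) => ℂ) (Fin.last n))) m.2 :=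
    (hG.differentiable (by simp) _).hasFDerivAt.comp m.2
      (ContinuousLinearMap.proj (R := ℝ) (φ := fun _ : Fin (n + 1) => ℂ) (Fin.last n)).hasFDerivAt
  have h := h2.exp.smul h1
  have e : conformal (lastFactor n G) (lam0 (n + 1)) = fun m : Model (n + 1) =>
      ((fun q : Fin (n + 1) → ℂ => Real.exp (G (q (Fin.last n)))) •
        fun q => ContinuousLinearMap.fst ℝ ℝ (Fin (n + 1) → ℂ) + lamLin (n + 1) q) m.2 :=
    funext fun m => by rw [conformal, lam0_eq]; rfl
  have hd : dlam (lam0 (n + 1)) m v w = lamLin (n + 1) v.2 w - lamLin (n + 1) w.2 v := by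
    rw [dlam_lam0, lamLin_apply, lamLin_apply, Finset.mul_sum, ← Finset.sum_sub_distrib]
    exact Finset.sum_congr rfl fun i _ => by ring
  rw [hd, lam0_eq, dlam, extd, e, differential_comp_snd h, ← fderiv_eq_inner_gradient,
    ← fderiv_eq_inner_gradient]
  simp
  ring

/-- The component in `ξ₀` of the Reeb vector field of `e^F λ₀`, up to the factor `e^F`. -/
def reebXi (G : ℂ → ℝ) (m : Model (n + 1)) : TModel (n + 1) :=
  (-lamLin (n + 1) m.2
      (0, Pi.single (Fin.last n) (-(Complex.I / 2) * gradient G (m.2 (Fin.last n)))),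
    Pi.single (Fin.last n) (-(Complex.I / 2) * gradient G (m.2 (Fin.last n))))

theorem lam0_reebXi (m : Model (n + 1)) : lam0 (n + 1) m (reebXi G m) = 0 := by
  rw [lam0_eq, reebXi]
  simp [lamLin_apply]

theorem sum_last_of_single (a : ℂ) (w : Fin (n + 1) → ℂ) :
    ∑ i, (((Pi.single (Fin.last n) a : Fin (n + 1) → ℂ) i).re * (w i).im -
      ((Pi.single (Fin.last n) a : Fin (n + 1) → ℂ) i).im * (w i).re) =
      a.re * (w (Fin.last n)).im - a.im * (w (Fin.last n)).re := by
  rw [Finset.sum_eq_single (Fin.last n)]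
  · simp
  · intro i _ hi
    simp [Pi.single_eq_of_ne hi]
  · simp

/-- For `∂_θ + X` with `X` in `ξ₀`, the Reeb condition becomes `dλ₀(X, ·) = dG` together with `dG(X)
= 0`. Both hold for the lift `X` of `-(i/2)∇G`, the second because `i∇G` is orthogonal to `∇G`. -/
theorem isReebVector_conformal (hG : ContDiff ℝ ∞ G) (m : Model (n + 1)) :
    IsReebVector (conformal (lastFactor n G) (lam0 (n + 1))) m
      (Real.exp (-G (m.2 (Fin.last n))) • ((1, 0) + reebXi G m)) := by
  have hl : lam0 (n + 1) m ((1, 0) + reebXi G m) = 1 := by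
    rw [map_add, lam0_reebXi, lam0_apply]
    simp
  constructor
  · rw [map_smul, conformal_apply, hl, smul_eq_mul, mul_one, ← Real.exp_add, neg_add_cancel,
      Real.exp_zero]
  · intro v
    rw [dlam_conformal hG, dlam_lam0, map_smul, hl]
    have hs : ∀ i, (Real.exp (-G (m.2 (Fin.last n))) • ((1, 0) + reebXi G m)).2 i =
        (Pi.single (Fin.last n) (Real.exp (-G (m.2 (Fin.last n))) *
          (-(Complex.I / 2) * gradient G (m.2 (Fin.last n)))) : Fin (n + 1) → ℂ) i := by
      intro i
      rcases eq_or_ne i (Fin.last n) with rfl | hi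
      · simp [reebXi]
      · simp [reebXi, Pi.single_eq_of_ne hi]
    simp only [hs, sum_last_of_single]
    simp only [Pi.single_eq_same, Complex.inner]
    generalize Real.exp (-G (m.2 (Fin.last n))) = E
    simp
    ring

/-- This is uniqueness of Reeb vectors: a difference `D` of two of them lies in `ξ₀`, where `d(e^G
λ₀)` is `e^G dλ₀`, and `dλ₀(D, J D) = 0` forces `D = 0`. -/
theorem reeb_conformal (hG : ContDiff ℝ ∞ G) (m : Model (n + 1)) :
    reeb (conformal (lastFactor n G) (lam0 (n + 1))) m =
      Real.exp (-G (m.2 (Fin.last n))) • ((1, 0) + reebXi G m) := by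
  have h1 := isReebVector_conformal hG m
  have h2 : IsReebVector (conformal (lastFactor n G) (lam0 (n + 1))) m
      (reeb (conformal (lastFactor n G) (lam0 (n + 1))) m) := Classical.epsilon_spec ⟨_, h1⟩
  generalize reeb (conformal (lastFactor n G) (lam0 (n + 1))) m = X at h2 ⊢
  generalize Real.exp (-G (m.2 (Fin.last n))) • ((1, 0) + reebXi G m) = Y at h1
  have hpos := Real.exp_pos (G (m.2 (Fin.last n)))
  have hJ := isCompatible_stdJ (n + 1)
  have hl : lam0 (n + 1) m (X - Y) = 0 := by
    have := h2.1.trans h1.1.symm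
    rw [conformal_apply, conformal_apply] at this
    rw [map_sub, sub_eq_zero]
    exact mul_left_cancel₀ hpos.ne' this
  have hd : dlam (conformal (lastFactor n G) (lam0 (n + 1))) m (X - Y) (stdJ (n + 1) m (X - Y)) =
      0 := by
    have : ∀ w, dlam (conformal (lastFactor n G) (lam0 (n + 1))) m (X - Y) w =
        dlam (conformal (lastFactor n G) (lam0 (n + 1))) m X w -
        dlam (conformal (lastFactor n G) (lam0 (n + 1))) m Y w := fun w => by
      simp only [dlam, extd, map_sub, sub_apply]
      ring
    rw [this, h1.2, h2.2, sub_zero]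
  rw [dlam_conformal hG, hl, hJ.mapsTo m _ hl, mul_zero, mul_zero, add_zero, sub_zero] at hd
  by_contra hne
  exact (mul_pos hpos (hJ.pos m _ hl (sub_ne_zero.2 hne))).ne' hd

theorem stdJ_reebXi (m : Model (n + 1)) :
    stdJ (n + 1) m (reebXi G m) =
      (-lamLin (n + 1) m.2 (0, Pi.single (Fin.last n) ((1 / 2 : ℂ) * gradient G (m.2 (Fin.last n)))),
        Pi.single (Fin.last n) ((1 / 2 : ℂ) * gradient G (m.2 (Fin.last n)))) := by
  have : Complex.I • (Pi.single (Fin.last n) (-(Complex.I / 2) * gradient G (m.2 (Fin.last n))) :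
      Fin (n + 1) → ℂ) =
      Pi.single (Fin.last n) ((1 / 2 : ℂ) * gradient G (m.2 (Fin.last n))) := by
    rw [← Pi.single_smul']
    congr 1
    rw [smul_eq_mul, ← mul_assoc, mul_neg, ← mul_div_assoc, Complex.I_mul_I]
    ring
  rw [stdJ_apply, reebXi, this]

end Conformal

/-! ### The cylinders -/

section Cylinder

theorem Cyl.log_exp_eventually : ∀ᶠ x : ℝ × ℝ in 𝓝 0, Cyl.log (Cyl.exp x) = x := by
  have : ∀ᶠ x : ℝ × ℝ in 𝓝 0, x.2 ∈ Ioo (-1 / 2 : ℝ) (1 / 2) :=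
    continuous_snd.continuousAt.preimage_mem_nhds (Ioo_mem_nhds (by norm_num) (by norm_num))
  filter_upwards [this] with x hx
  refine Prod.ext rfl ?_
  exact AddCircle.equivIoc_coe_of_mem (p := (1 : ℝ)) (a := -1 / 2) ⟨hx.1, by linarith [hx.2]⟩

theorem toReal_coe_eventually : ∀ᶠ x : ℝ in 𝓝 0, (x : Real.Angle).toReal = x := by
  filter_upwards [Ioo_mem_nhds (neg_lt_zero.2 Real.pi_pos) Real.pi_pos] with x hx
  exact Real.Angle.toReal_coe_eq_self_iff.2 ⟨hx.1, hx.2.le⟩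

/-- The isomorphism `ℝ/ℤ → ℝ/2πℤ` given by multiplication with `2π`. -/
def turn : UnitAddCircle ≃+ Real.Angle :=
  AddCircle.equivAddCircle 1 (2 * Real.pi) one_ne_zero Real.two_pi_pos.ne'

theorem turn_coe (x : ℝ) : turn (x : UnitAddCircle) = ((2 * Real.pi * x : ℝ) : Real.Angle) := by
  refine (AddCircle.equivAddCircle_apply_mk 1 (2 * Real.pi) one_ne_zero Real.two_pi_pos.ne'
    x).trans ?_
  congr 1
  ring

theorem snoc_sub_snoc {n : ℕ} (p : Fin n → ℂ) (a b : ℂ) :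
    (Fin.snoc p a : Fin (n + 1) → ℂ) - Fin.snoc p b = Pi.single (Fin.last n) (a - b) := by
  funext i
  refine Fin.lastCases ?_ (fun j => ?_) i
  · simp
  · simp

variable {n : ℕ}

/-- The map `(s, t) ↦ (θ(s) + 2π t, p, z(s))`. -/
def rotCylinder (p : Fin n → ℂ) (θ : ℝ → ℝ) (z : ℝ → ℂ) (c : Cyl) : Model (n + 1) :=
  ((θ c.1 : Real.Angle) + turn c.2, Fin.snoc p (z c.1))

variable (p : Fin n → ℂ) {θ : ℝ → ℝ} {z : ℝ → ℂ}

theorem localRep_rotCylinder (hθ : Continuous θ) (c : Cyl) :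
    localRep Cyl.exp Model.log (rotCylinder p θ z) c =ᶠ[𝓝 0]
      fun x => (θ (c.1 + x.1) - θ c.1 + 2 * Real.pi * x.2,
        Pi.single (Fin.last n) (z (c.1 + x.1) - z c.1)) := by
  have hc : Continuous fun x : ℝ × ℝ => θ (c.1 + x.1) - θ c.1 + 2 * Real.pi * x.2 := by fun_prop
  filter_upwards [(hc.tendsto' 0 0 (by simp)).eventually toReal_coe_eventually] with x hx
  have h1 : (θ (c.1 + x.1) : Real.Angle) + turn (c.2 + (x.2 : UnitAddCircle)) -
      ((θ c.1 : Real.Angle) + turn c.2) =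
      ((θ (c.1 + x.1) - θ c.1 + 2 * Real.pi * x.2 : ℝ) : Real.Angle) := by
    rw [map_add, turn_coe, Real.Angle.coe_add, Real.Angle.coe_sub]
    abel
  refine Prod.ext ?_ (snoc_sub_snoc p _ _)
  refine Eq.trans ?_ hx
  exact congrArg Real.Angle.toReal h1

theorem hasFDerivAt_comp_fst {E : Type*} [NormedAddCommGroup E] [NormedSpace ℝ E] {f : ℝ → E}
    {f' : E} {s : ℝ} (hf : HasDerivAt f f' s) :
    HasFDerivAt (fun x : ℝ × ℝ => f (s + x.1) - f s)
      ((ContinuousLinearMap.fst ℝ ℝ ℝ).smulRight f') 0 := by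
  have h1 : HasFDerivAt (fun x : ℝ × ℝ => s + x.1) (ContinuousLinearMap.fst ℝ ℝ ℝ) 0 :=
    hasFDerivAt_fst.const_add s
  have hf0 : HasFDerivAt f (ContinuousLinearMap.toSpanSingleton ℝ f') (s + (0 : ℝ × ℝ).1) := by
    simpa using hf.hasFDerivAt
  refine ((hf0.comp (0 : ℝ × ℝ) h1).sub_const (f s)).congr_fderiv ?_
  ext <;> simp

theorem contDiff_pi_single : ContDiff ℝ ∞ (fun a : ℂ => (Pi.single (Fin.last n) a :
    Fin (n + 1) → ℂ)) :=
  (ContinuousLinearMap.single ℝ (fun _ : Fin (n + 1) => ℂ) (Fin.last n)).contDiff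

theorem smoothAt_rotCylinder (hθ : ContDiff ℝ ∞ θ) (hz : ContDiff ℝ ∞ z) (c : Cyl) :
    SmoothAt Cyl.exp Model.log (rotCylinder p θ z) c := by
  have : ContDiff ℝ ∞ fun x : ℝ × ℝ => (θ (c.1 + x.1) - θ c.1 + 2 * Real.pi * x.2,
        (Pi.single (Fin.last n) (z (c.1 + x.1) - z c.1) : Fin (n + 1) → ℂ)) := by
    refine ContDiff.prodMk (by fun_prop) (contDiff_pi_single.comp (by fun_prop))
  exact this.contDiffAt.congr_of_eventuallyEq (localRep_rotCylinder p hθ.continuous c)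

theorem du_rotCylinder (hθc : Continuous θ) {c : Cyl} {θ' : ℝ} {z' : ℂ} (hθ : HasDerivAt θ θ' c.1)
    (hz : HasDerivAt z z' c.1) (v : ℝ × ℝ) :
    du (rotCylinder p θ z) c v =
      (v.1 * θ' + 2 * Real.pi * v.2, Pi.single (Fin.last n) (v.1 • z')) := by
  have h2 := (ContinuousLinearMap.single ℝ (fun _ : Fin (n + 1) => ℂ) (Fin.last n)).hasFDerivAt.comp
    (0 : ℝ × ℝ) (hasFDerivAt_comp_fst hz)
  have h1 := (hasFDerivAt_comp_fst hθ).add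
    ((ContinuousLinearMap.snd ℝ ℝ ℝ).hasFDerivAt.const_mul (2 * Real.pi))
  rw [du, differential, (localRep_rotCylinder p hθc c).fderiv_eq]
  refine (DFunLike.congr_fun (h1.prodMk h2).fderiv v).trans ?_
  simp

/-- A function of `s` on the cylinder. -/
theorem smoothAt_comp_fst {E : Type*} [NormedAddCommGroup E] [NormedSpace ℝ E] {f : ℝ → E}
    (hf : ContDiff ℝ ∞ f) (c : Cyl) : SmoothAt Cyl.exp id (fun c => f c.1) c := by
  have : ContDiff ℝ ∞ fun x : ℝ × ℝ => f (c.1 + x.1) - f c.1 := by fun_prop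
  exact this.contDiffAt

theorem differential_comp_fst {E : Type*} [NormedAddCommGroup E] [NormedSpace ℝ E] {f : ℝ → E}
    {f' : E} {c : Cyl} (hf : HasDerivAt f f' c.1) (v : ℝ × ℝ) :
    differential Cyl.exp id (fun c => f c.1) c v = v.1 • f' :=
  DFunLike.congr_fun (hasFDerivAt_comp_fst hf).fderiv v

variable {G : ℂ → ℝ}

/-- The equation for `θ` says that `∂_s u` is tangent to `ξ₀`; only the rotation `∂_t u`
contributes. -/
theorem lam0_du_rotCylinder (hθc : Continuous θ) {c : Cyl} {z' : ℂ}
    (hθ : HasDerivAt θ ((z c.1).im * z'.re - (z c.1).re * z'.im) c.1)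
    (hz : HasDerivAt z z' c.1) (v : ℝ × ℝ) :
    lam0 (n + 1) (rotCylinder p θ z c) (du (rotCylinder p θ z) c v) = 2 * Real.pi * v.2 := by
  rw [du_rotCylinder p hθc hθ hz, lam0_apply]
  have hs := sum_last_of_single (n := n) (v.1 • z') (rotCylinder p θ z c).2
  have : ∀ i, ((rotCylinder p θ z c).2 i).re *
      ((Pi.single (Fin.last n) (v.1 • z') : Fin (n + 1) → ℂ) i).im -
      ((rotCylinder p θ z c).2 i).im *
      ((Pi.single (Fin.last n) (v.1 • z') : Fin (n + 1) → ℂ) i).re =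
      -(((Pi.single (Fin.last n) (v.1 • z') : Fin (n + 1) → ℂ) i).re *
        ((rotCylinder p θ z c).2 i).im -
      ((Pi.single (Fin.last n) (v.1 • z') : Fin (n + 1) → ℂ) i).im *
        ((rotCylinder p θ z c).2 i).re) := fun i => by ring
  simp only [this, Finset.sum_neg_distrib, hs]
  simp [rotCylinder]
  ring

theorem isPseudoholomorphic_rotCylinder (hG : ContDiff ℝ ∞ G) {α : ℝ → ℝ} (hα : ContDiff ℝ ∞ α)
    (hθ : ContDiff ℝ ∞ θ) (hz : ContDiff ℝ ∞ z)
    (hα' : ∀ s, HasDerivAt α (2 * Real.pi * Real.exp (G (z s))) s)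
    (hz' : ∀ s, HasDerivAt z (Real.pi • gradient G (z s)) s)
    (hθ' : ∀ s, HasDerivAt θ ((z s).im * (Real.pi • gradient G (z s)).re -
      (z s).re * (Real.pi • gradient G (z s)).im) s) :
    IsPseudoholomorphic (conformal (lastFactor n G) (lam0 (n + 1))) (stdJ (n + 1))
      (fun c => α c.1) (rotCylinder p θ z) where
  smooth_a c := smoothAt_comp_fst hα c
  smooth_u c := smoothAt_rotCylinder p hθ hz c
  eq_xi c v := by
    have hJ := isCompatible_stdJ (n + 1)
    have hlast : (rotCylinder p θ z c).2 (Fin.last n) = z c.1 := by simp [rotCylinder]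
    set m := rotCylinder p θ z c with hm
    have hJX := stdJ_reebXi (G := G) m
    have hexp : Real.exp (G (z c.1)) * Real.exp (-G (z c.1)) = 1 := by
      rw [← Real.exp_add, add_neg_cancel, Real.exp_zero]
    -- With `X = reebXi G m`: `∂_s u = 2π J X`, and `∂_t u = 2π ∂_θ` projects to `-2π X`. The
    -- equation then follows from `J² = -1`.
    have key : ∀ v : ℝ × ℝ, projXi (conformal (lastFactor n G) (lam0 (n + 1))) m
        (du (rotCylinder p θ z) c v) = (2 * Real.pi * v.1) • stdJ (n + 1) m (reebXi G m) -
          (2 * Real.pi * v.2) • reebXi G m := by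
      intro v
      rw [projXi, reeb_conformal hG, conformal_apply, hlast,
        lam0_du_rotCylinder p hθ.continuous (hθ' c.1) (hz' c.1), smul_smul,
        mul_right_comm, hexp, one_mul, smul_add, ← sub_sub]
      congr 1
      rw [du_rotCylinder p hθ.continuous (hθ' c.1) (hz' c.1), hJX, hlast]
      refine Prod.ext ?_ ?_
      · have hlin : lamLin (n + 1) m.2
            (0, Pi.single (Fin.last n) ((1 / 2 : ℂ) * gradient G (z c.1))) =
            (z c.1).re * (1 / 2 * (gradient G (z c.1)).im) -
              (z c.1).im * (1 / 2 * (gradient G (z c.1)).re) := by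
          have hs := sum_last_of_single (n := n) ((1 / 2 : ℂ) * gradient G (z c.1)) m.2
          rw [hlast] at hs
          rw [lamLin_apply]
          calc _ = -∑ i, (((Pi.single (Fin.last n) ((1 / 2 : ℂ) * gradient G (z c.1)) :
                Fin (n + 1) → ℂ) i).re * (m.2 i).im -
              ((Pi.single (Fin.last n) ((1 / 2 : ℂ) * gradient G (z c.1)) :
                Fin (n + 1) → ℂ) i).im * (m.2 i).re) := by
                rw [← Finset.sum_neg_distrib]
                exact Finset.sum_congr rfl fun i _ => by ring
            _ = _ := by
                rw [hs]
                simp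
                ring
        simp only [Prod.fst_sub, Prod.smul_fst, hlin, smul_eq_mul]
        simp
        ring
      · simp only [Prod.snd_sub, Prod.smul_snd, smul_zero, sub_zero]
        rw [← Pi.single_smul']
        congr 1
        simp only [Complex.real_smul]
        push_cast
        ring
    rw [key, key, map_sub, map_smul, map_smul, hJ.sq m _ (lam0_reebXi m)]
    simp only [Cyl.rot]
    module
  eq_reeb c v := by
    have hlast : (rotCylinder p θ z c).2 (Fin.last n) = z c.1 := by simp [rotCylinder]
    rw [conformal_apply, hlast, lam0_du_rotCylinder p hθ.continuous (hθ' c.1) (hz' c.1),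
      differential_comp_fst (hα' c.1)]
    simp [Cyl.rot]
    ring

end Cylinder

/-! ### Energy -/

section Energy

/-- The integral of the derivative of a monotone function is at most its oscillation. -/
theorem lintegral_deriv_le {β β' : ℝ → ℝ} (hβ : ∀ s, HasDerivAt β (β' s) s) (hc : Continuous β')
    (hpos : ∀ s, 0 ≤ β' s) {A : ℝ} (h0 : ∀ s, 0 ≤ β s) (hA : ∀ s, β s ≤ A) :
    ∫⁻ s, ENNReal.ofReal (β' s) ≤ ENNReal.ofReal A := by
  have hcov := aecover_Ioc (μ := (volume : Measure ℝ)) (l := atTop) tendsto_neg_atTop_atBot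
    (tendsto_id (α := ℝ) (x := atTop))
  refine le_of_tendsto (hcov.lintegral_tendsto_of_countably_generated
    (hc.measurable.ennreal_ofReal.aemeasurable)) ?_
  filter_upwards [eventually_ge_atTop (0 : ℝ)] with r hr
  have hle : -r ≤ id r := by simp; linarith
  rw [← ofReal_integral_eq_lintegral_ofReal (hc.integrableOn_Ioc)
    (Eventually.of_forall hpos), ← intervalIntegral.integral_of_le hle,
    intervalIntegral.integral_eq_sub_of_hasDerivAt (fun s _ => hβ s) (hc.intervalIntegrable _ _)]
  exact ENNReal.ofReal_le_ofReal (by linarith [h0 (-r), hA (id r)])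

variable {n : ℕ} (p : Fin n → ℂ) {θ : ℝ → ℝ} {z : ℝ → ℂ} {G : ℂ → ℝ}

theorem hoferEnergy_rotCylinder_lt_top (hG : ContDiff ℝ ∞ G) (hG1 : ∀ z, G z ≤ 1) {α : ℝ → ℝ}
    (hα : ContDiff ℝ ∞ α) (hθ : ContDiff ℝ ∞ θ) (hz : ContDiff ℝ ∞ z)
    (hα' : ∀ s, HasDerivAt α (2 * Real.pi * Real.exp (G (z s))) s)
    (hz' : ∀ s, HasDerivAt z (Real.pi • gradient G (z s)) s)
    (hθ' : ∀ s, HasDerivAt θ ((z s).im * (Real.pi • gradient G (z s)).re -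
      (z s).re * (Real.pi • gradient G (z s)).im) s) :
    hoferEnergy (conformal (lastFactor n G) (lam0 (n + 1))) (fun c => α c.1) (rotCylinder p θ z) <
      ⊤ := by
  refine lt_of_le_of_lt (iSup₂_le fun φ hφ => ?_)
    (ENNReal.ofReal_lt_top (r := 2 * Real.pi * Real.exp 1))
  obtain ⟨hφs, hφI, hφ', -, -⟩ := hφ
  have hpi := Real.pi_pos
  -- Here `φ(a) u^*λ = β(s) dt`, so the energy density is `β'`. It is nonnegative because `φ ∘ α`
  -- and `G ∘ z` are both nondecreasing.
  set β : ℝ → ℝ := fun s => φ (α s) * (2 * Real.pi * Real.exp (G (z s)))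
  have hβs : ContDiff ℝ ∞ β :=
    (hφs.comp hα).mul (contDiff_const.mul (Real.contDiff_exp.comp (hG.comp hz)))
  have hβ : ∀ s, HasDerivAt β (deriv β s) s := fun s =>
    (hβs.differentiable (by simp) s).hasDerivAt
  have hpos : ∀ s, 0 ≤ deriv β s := by
    intro s
    have h1 := ((hφs.differentiable (by simp) (α s)).hasDerivAt.comp s (hα' s)).mul
      ((hasDerivAt_comp_gradientLine (hG.differentiable (by simp)) hz' s).exp.const_mul
        (2 * Real.pi))
    rw [show deriv β s = _ from h1.deriv]
    have := hφ' (α s)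
    have := (hφI (α s)).1
    simp only [Function.comp]
    positivity
  have hη : (fun c' : Cyl => φ (α c'.1) •
      pullback (conformal (lastFactor n G) (lam0 (n + 1))) (rotCylinder p θ z) c') =
      fun c' => (fun s => β s • ContinuousLinearMap.snd ℝ ℝ ℝ) c'.1 := by
    funext c'
    refine ContinuousLinearMap.ext fun v => ?_
    have hlast : (rotCylinder p θ z c').2 (Fin.last n) = z c'.1 := by simp [rotCylinder]
    simp only [smul_apply, pullback, ContinuousLinearMap.comp_apply,
      conformal_apply, hlast, lam0_du_rotCylinder p hθ.continuous (hθ' c'.1) (hz' c'.1), β,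
      ContinuousLinearMap.coe_snd', smul_eq_mul]
    ring
  have hext : ∀ c : Cyl, extd Cyl.exp (fun c' : Cyl => φ (α c'.1) •
      pullback (conformal (lastFactor n G) (lam0 (n + 1))) (rotCylinder p θ z) c') c (1, 0) (0, 1) =
      deriv β c.1 := by
    intro c
    rw [hη, extd, differential_comp_fst ((hβ c.1).smul_const _),
      differential_comp_fst ((hβ c.1).smul_const _)]
    simp
  have hc : Continuous (deriv β) := hβs.continuous_deriv (by simp)
  simp only [hext]
  rw [Measure.volume_eq_prod, lintegral_prod (fun c : Cyl => ENNReal.ofReal (deriv β c.1))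
    (hc.measurable.comp measurable_fst).ennreal_ofReal.aemeasurable]
  simp only [lintegral_const, UnitAddCircle.measure_univ, mul_one]
  refine lintegral_deriv_le hβ hc hpos (fun s => ?_) (fun s => ?_)
  · have := (hφI (α s)).1
    simp only [β]
    positivity
  · have h1 := (hφI (α s)).2
    have h2 := Real.exp_le_exp.2 (hG1 (z s))
    calc β s ≤ 1 * (2 * Real.pi * Real.exp (G (z s))) :=
          mul_le_mul_of_nonneg_right h1 (by positivity)
      _ ≤ 2 * Real.pi * Real.exp 1 := by rw [one_mul]; gcongr

end Energy

/-! ### Cylindrical coordinates -/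

theorem isCylindricalCoordinates_id : IsCylindricalCoordinates atTop (fun c => c) := by
  have hrep : ∀ c : Cyl, localRep Cyl.exp Cyl.log (fun c : Cyl => c) c =ᶠ[𝓝 0] id := by
    intro c
    filter_upwards [Cyl.log_exp_eventually] with x hx
    simpa [localRep] using hx
  have hd : ∀ c : Cyl, differential Cyl.exp Cyl.log (fun c : Cyl => c) c =
      ContinuousLinearMap.id ℝ (ℝ × ℝ) := fun c => by
    rw [differential, (hrep c).fderiv_eq, fderiv_id]
  exact
    { continuousOn := continuous_id.continuousOn
      injOn := injOn_id _
      smooth := fun c _ => contDiffAt_id.congr_of_eventuallyEq (hrep c)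
      holomorphic := fun c _ v => by rw [hd]; rfl
      tendsto := fun _ => tendsto_id }

theorem isCylindricalCoordinates_neg : IsCylindricalCoordinates atBot (fun c => -c) := by
  have hrep : ∀ c : Cyl, localRep Cyl.exp Cyl.log (fun c : Cyl => -c) c =ᶠ[𝓝 0] Neg.neg := by
    intro c
    have h0 : Tendsto (Neg.neg : ℝ × ℝ → ℝ × ℝ) (𝓝 0) (𝓝 0) := continuous_neg.tendsto' 0 0 neg_zero
    filter_upwards [h0.eventually Cyl.log_exp_eventually] with x hx
    have he : Cyl.exp (-x) = -Cyl.exp x := Prod.ext rfl (AddCircle.coe_neg 1)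
    rw [he] at hx
    simpa [localRep] using hx
  have hd : ∀ c : Cyl, differential Cyl.exp Cyl.log (fun c : Cyl => -c) c =
      -ContinuousLinearMap.id ℝ (ℝ × ℝ) := fun c => by
    rw [differential, (hrep c).fderiv_eq]
    exact (hasFDerivAt_id (0 : ℝ × ℝ)).neg.fderiv
  exact
    { continuousOn := continuous_neg.continuousOn
      injOn := neg_injective.injOn
      smooth := fun c _ => contDiff_neg.contDiffAt.congr_of_eventuallyEq (hrep c)
      holomorphic := fun c _ v => by
        rw [hd]
        simp [Cyl.rot]
      tendsto := fun _ => tendsto_neg_atTop_atBot }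

/-! ### Translates of a one-parameter loop -/

section Loops

variable {n : ℕ}

/-- The loop `t ↦ A + (2π ε t, 0)`. -/
def rotLoop (ε : ℤ) (A : Model n) (t : UnitAddCircle) : Model n := A + (turn (ε • t), 0)

/-- The expression does not depend on `A`, so all translates have the same derivatives and `C^∞`
convergence reduces to convergence of the base points. -/
theorem loopRep_rotLoop (ε : ℤ) (A : Model n) (t : UnitAddCircle) :
    loopRep (rotLoop ε A) t = fun x : ℝ => ((turn (ε • (x : UnitAddCircle))).toReal, 0) := by
  funext x
  have : rotLoop ε A (t + (x : UnitAddCircle)) - rotLoop ε A t =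
      (turn (ε • (x : UnitAddCircle)), 0) := by
    rw [rotLoop, rotLoop, smul_add, map_add, add_sub_add_left_eq_sub]
    simp
  rw [loopRep, localRep, this]
  rfl

theorem loopRep_rotLoop_eventuallyEq (ε : ℤ) (A : Model n) (t : UnitAddCircle) :
    loopRep (rotLoop ε A) t =ᶠ[𝓝 0] fun x : ℝ => (2 * Real.pi * ε * x, 0) := by
  rw [loopRep_rotLoop]
  have hc : Continuous fun x : ℝ => 2 * Real.pi * ε * x := by fun_prop
  filter_upwards [(hc.tendsto' 0 0 (by simp)).eventually toReal_coe_eventually] with x hx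
  rw [← AddCircle.coe_zsmul, turn_coe, zsmul_eq_mul, ← mul_assoc, hx]

theorem isSmoothLoop_rotLoop (ε : ℤ) (A : Model n) : IsSmoothLoop (rotLoop ε A) := by
  intro t
  have : ContDiff ℝ ∞ fun x : ℝ => ((2 * Real.pi * ε * x, 0) : TModel n) := by fun_prop
  exact this.contDiffAt.congr_of_eventuallyEq (loopRep_rotLoop_eventuallyEq ε A t)

theorem loopDeriv_one_rotLoop (ε : ℤ) (A : Model n) (t : UnitAddCircle) :
    loopDeriv 1 (rotLoop ε A) t = (2 * Real.pi * ε, 0) := by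
  rw [loopDeriv, iteratedDeriv_one, (loopRep_rotLoop_eventuallyEq ε A t).deriv_eq]
  have h := ((hasDerivAt_id (0 : ℝ)).const_mul (2 * Real.pi * ε)).prodMk
    (hasDerivAt_const (0 : ℝ) (0 : Fin n → ℂ))
  rw [mul_one] at h
  exact h.deriv

theorem tendstoSmoothly_rotLoop (ε : ℤ) {A : ℕ → Model n} {B : Model n}
    (hA : Tendsto A atTop (𝓝 B)) : TendstoSmoothly (fun j => rotLoop ε (A j)) (rotLoop ε B) := by
  constructor
  · rw [Metric.tendstoUniformly_iff]
    intro δ hδ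
    filter_upwards [hA (Metric.ball_mem_nhds B hδ)] with j hj t
    rw [rotLoop, rotLoop, dist_add_right, dist_comm]
    exact hj
  · intro k _
    have : ∀ j, loopDeriv k (rotLoop ε (A j)) = loopDeriv k (rotLoop ε B) := fun j => by
      funext t
      rw [loopDeriv, loopDeriv, loopRep_rotLoop, loopRep_rotLoop]
    rw [Metric.tendstoUniformly_iff]
    intro δ hδ
    refine Eventually.of_forall fun j t => ?_
    rw [this, dist_self]
    exact hδ

variable {G : ℂ → ℝ}

theorem isPeriodicOrbit_rotLoop (hG : ContDiff ℝ ∞ G) {ε : ℤ} (hε : ε ≠ 0) {A : Model (n + 1)}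
    (hA : gradient G (A.2 (Fin.last n)) = 0) :
    IsPeriodicOrbit (conformal (lastFactor n G) (lam0 (n + 1))) (rotLoop ε A) := by
  -- Over a critical point the Reeb vector is `e^{-G} ∂_θ`. For `ε < 0` the period `T` is negative,
  -- which the definition of periodic orbit allows.
  refine ⟨isSmoothLoop_rotLoop ε A, 2 * Real.pi * ε * Real.exp (G (A.2 (Fin.last n))), ?_,
    fun t => ?_⟩
  · have : (ε : ℝ) ≠ 0 := by exact_mod_cast hε
    have := Real.pi_ne_zero
    positivity
  · have hlast : (rotLoop ε A t).2 (Fin.last n) = A.2 (Fin.last n) := by simp [rotLoop]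
    have hY : reebXi G (rotLoop ε A t) = 0 := by
      simp [reebXi, hlast, hA, lamLin_apply]
    rw [loopDeriv_one_rotLoop, reeb_conformal hG, hY, hlast, add_zero, smul_smul, mul_assoc _ _
      (Real.exp (-_)), ← Real.exp_add, add_neg_cancel, Real.exp_zero]
    simp

theorem mem_range_rotLoop {ε : ℤ} (hε : ε = 1 ∨ ε = -1) (x : Real.Angle) (m : Model n) :
    m ∈ range (rotLoop ε (x, m.2)) := by
  have hεε : ε * ε = 1 := by rcases hε with rfl | rfl <;> norm_num
  refine ⟨ε • turn.symm (m.1 - x), ?_⟩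
  rw [rotLoop, smul_smul, hεε, one_smul, AddEquiv.apply_symm_apply]
  simp

end Loops

/-! ### Limit sets of the cylinders -/

section LimitSet

variable {n : ℕ} (p : Fin n → ℂ) {θ : ℝ → ℝ} {z : ℝ → ℂ} {G : ℂ → ℝ} {rm rp : ℝ}

theorem rotCylinder_eq_rotLoop {ε : ℤ} (s : ℝ) (t : UnitAddCircle) :
    rotCylinder p θ z (s, ε • t) = rotLoop ε ((θ s : Real.Angle), Fin.snoc p (z s)) t := by
  simp [rotCylinder, rotLoop]

/-- No control of `θ` at infinity is needed: by compactness of the circle it converges along a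
subsequence, and the limiting fibre passes through `m` whatever that limit is. -/
theorem mem_iUnion_limitSet (hG : ContDiff ℝ ∞ G) {ε : ℤ} (hε : ε = 1 ∨ ε = -1) {P : Filter ℝ}
    (hP : P = atTop ∨ P = atBot) (hψ : IsCylindricalCoordinates P (fun c => ε • c)) {σ : ℕ → ℝ}
    (hσ : Tendsto σ atTop atTop) {m : Model (n + 1)} (hp : ∀ i, m.2 (Fin.castSucc i) = p i)
    (hm : gradient G (m.2 (Fin.last n)) = 0)
    (hz : Tendsto (fun j => z (ε • σ j)) atTop (𝓝 (m.2 (Fin.last n)))) :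
    m ∈ ⋃ γ ∈ limitSet (conformal (lastFactor n G) (lam0 (n + 1))) (rotCylinder p θ z),
      range γ := by
  have : CompactSpace Real.Angle :=
    haveI : Fact (0 < 2 * Real.pi) := ⟨Real.two_pi_pos⟩
    inferInstanceAs (CompactSpace (AddCircle (2 * Real.pi)))
  obtain ⟨x, f, hf, hx⟩ := CompactSpace.tendsto_subseq fun j => ((θ (ε • σ j) : ℝ) : Real.Angle)
  have hsnoc : (Fin.snoc p (m.2 (Fin.last n)) : Fin (n + 1) → ℂ) = m.2 := by
    funext i
    refine Fin.lastCases ?_ (fun j => ?_) i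
    · simp
    · simp [hp]
  have hlim : Tendsto (fun j => (((θ (ε • σ (f j)) : ℝ) : Real.Angle),
      (Fin.snoc p (z (ε • σ (f j))) : Fin (n + 1) → ℂ))) atTop (𝓝 (x, m.2)) := by
    refine hx.prodMk_nhds (tendsto_pi_nhds.2 fun i => ?_)
    refine Fin.lastCases ?_ (fun j => ?_) i
    · simpa [Function.comp_def] using hz.comp hf.tendsto_atTop
    · simp [hp]
  refine mem_iUnion₂.2 ⟨rotLoop ε (x, m.2), ⟨isPeriodicOrbit_rotLoop hG ?_ hm, P, _,
    fun j => σ (f j), hP, hψ, hσ.comp hf.tendsto_atTop, ?_⟩, mem_range_rotLoop hε x m⟩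
  · rcases hε with rfl | rfl <;> norm_num
  · have := tendstoSmoothly_rotLoop ε hlim
    refine cast (congrArg (fun v => TendstoSmoothly v _) ?_) this
    funext j t
    exact (rotCylinder_eq_rotLoop p (ε • σ (f j)) t).symm

/-- If `|z|` tends to `rp` and `rm` at `±∞` and `z` accumulates at all points of these circles, which
consist of critical points of `G`, then the limit set of the cylinder fills two tori. -/
theorem iUnion_limitSet_rotCylinder (hG : ContDiff ℝ ∞ G)
    (hcrit : ∀ z, ‖z‖ = rm ∨ ‖z‖ = rp → gradient G z = 0)
    (ht : Tendsto (fun s => ‖z s‖) atTop (𝓝 rp)) (hb : Tendsto (fun s => ‖z s‖) atBot (𝓝 rm))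
    (hp : ∀ ζ, ‖ζ‖ = rp → ∃ σ : ℕ → ℝ, Tendsto σ atTop atTop ∧
      Tendsto (fun j => z (σ j)) atTop (𝓝 ζ))
    (hm : ∀ ζ, ‖ζ‖ = rm → ∃ σ : ℕ → ℝ, Tendsto σ atTop atBot ∧
      Tendsto (fun j => z (σ j)) atTop (𝓝 ζ)) :
    (⋃ γ ∈ limitSet (conformal (lastFactor n G) (lam0 (n + 1))) (rotCylinder p θ z), range γ) =
      torus p rm ∪ torus p rp := by
  refine Subset.antisymm ?_ (union_subset ?_ ?_)
  · refine iUnion₂_subset fun γ hγ => range_subset_iff.2 fun t => ?_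
    obtain ⟨-, P, ψ, σ, hP, hψ, hσ, hu, -⟩ := hγ
    have hsnd : Tendsto (fun j => (rotCylinder p θ z (ψ (σ j, t))).2) atTop (𝓝 (γ t).2) :=
      (continuous_snd.tendsto _).comp (hu.tendsto_at t)
    -- For this inclusion pointwise convergence suffices, with arbitrary cylindrical coordinates:
    -- the limits of `p` and `|z|` depend only on the puncture.
    have hcoord := tendsto_pi_nhds.1 hsnd
    have h1 : ∀ i, (γ t).2 (Fin.castSucc i) = p i := fun i => by
      refine tendsto_nhds_unique (hcoord (Fin.castSucc i)) ?_
      simp [rotCylinder]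
    have h2 : Tendsto (fun j => ‖z (ψ (σ j, t)).1‖) atTop (𝓝 ‖(γ t).2 (Fin.last n)‖) := by
      simpa [rotCylinder] using (hcoord (Fin.last n)).norm
    have hψσ := (hψ.tendsto t).comp hσ
    rcases hP with rfl | rfl
    · exact Or.inr ⟨h1, tendsto_nhds_unique h2 (ht.comp hψσ)⟩
    · exact Or.inl ⟨h1, tendsto_nhds_unique h2 (hb.comp hψσ)⟩
  · rintro m ⟨hmp, hmr⟩
    obtain ⟨σ, hσ, hlim⟩ := hm _ hmr
    -- The coordinates `c ↦ -c` around `s = -∞` reverse `t` as well, as holomorphy requires.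
    exact mem_iUnion_limitSet p hG (ε := -1) (Or.inr rfl) (Or.inr rfl)
      (by simpa using isCylindricalCoordinates_neg) (tendsto_neg_atBot_atTop.comp hσ) hmp
      (hcrit _ (Or.inl hmr)) (by simpa using hlim)
  · rintro m ⟨hmp, hmr⟩
    obtain ⟨σ, hσ, hlim⟩ := hp _ hmr
    exact mem_iUnion_limitSet p hG (ε := 1) (Or.inl rfl) (Or.inl rfl)
      (by simpa using isCylindricalCoordinates_id) hσ hmp
      (hcrit _ (Or.inr hmr)) (by simpa using hlim)

end LimitSet

/-- Smooth functions on the line have smooth primitives with prescribed value at `0`. -/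
theorem exists_primitive {f : ℝ → ℝ} (hf : ContDiff ℝ ∞ f) (c : ℝ) :
    ∃ g : ℝ → ℝ, ContDiff ℝ ∞ g ∧ g 0 = c ∧ ∀ s, HasDerivAt g (f s) s := by
  have hg : ∀ s, HasDerivAt (fun s => c + ∫ r in (0 : ℝ)..s, f r) (f s) s := fun s =>
    (intervalIntegral.integral_hasDerivAt_right (hf.continuous.intervalIntegrable _ _)
      (hf.continuous.stronglyMeasurableAtFilter _ _) hf.continuous.continuousAt).const_add c
  refine ⟨_, contDiff_infty_iff_deriv.2 ⟨fun s => (hg s).differentiableAt, ?_⟩, by simp, hg⟩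
  rwa [show deriv (fun s => c + ∫ r in (0 : ℝ)..s, f r) = f from funext fun s => (hg s).deriv]

end KnotModel
end

/-! ### Assembly of the theorem -/

open KnotModel
theorem theorem5p1 (n : ℕ) (rm rp : ℝ) (hrm : 0 < rm) (hr : rm < rp) :
    ∃ (F : Model (n + 1) → ℝ) (J : Model (n + 1) → TModel (n + 1) →L[ℝ] TModel (n + 1)),
      (∀ m, SmoothAt Model.exp id F m) ∧
      IsCompatible (lam0 (n + 1)) J ∧
      ∀ (θ₀ : Real.Angle) (p : Fin n → ℂ) (z : ℂ), rm < ‖z‖ → ‖z‖ < rp →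
        ∃ (a : Cyl → ℝ) (u : Cyl → Model (n + 1)),
          IsFiniteEnergyCylinder (conformal F (lam0 (n + 1))) J a u ∧
          (∃ c : Cyl, u c = (θ₀, Fin.snoc p z)) ∧
          (⋃ γ ∈ limitSet (conformal F (lam0 (n + 1))) u, range γ) = torus p rm ∪ torus p rp := by
  obtain ⟨G, hG, -, hG1, hcrit, hflow⟩ := exists_spiralling_potential hrm hr
  refine ⟨lastFactor n G, stdJ (n + 1), smoothAt_lastFactor hG, isCompatible_stdJ (n + 1),
    fun θ₀ p z₀ h1 h2 => ?_⟩
  obtain ⟨z, rfl, hz', ht, hb, hp, hm⟩ := hflow z₀ h1 h2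
  have hgrad : ContDiff ℝ ∞ fun z => Real.pi • gradient G z :=
    (contDiff_gradient hG).const_smul Real.pi
  have hz : ContDiff ℝ ∞ z := contDiff_of_hasDerivAt hgrad hz'
  obtain ⟨α, hα, -, hα'⟩ := exists_primitive (f := fun s => 2 * Real.pi * Real.exp (G (z s)))
    (contDiff_const.mul (Real.contDiff_exp.comp (hG.comp hz))) 0
  have hre : ∀ {w : ℝ → ℂ}, ContDiff ℝ ∞ w → ContDiff ℝ ∞ fun s => (w s).re :=
    fun hw => Complex.reCLM.contDiff.comp hw
  have him : ∀ {w : ℝ → ℂ}, ContDiff ℝ ∞ w → ContDiff ℝ ∞ fun s => (w s).im :=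
    fun hw => Complex.imCLM.contDiff.comp hw
  -- The initial value `θ₀.toReal` makes the cylinder pass through the given point at `(0, 0)`.
  obtain ⟨θ, hθ, hθ0, hθ'⟩ := exists_primitive
    (f := fun s => (z s).im * (Real.pi • gradient G (z s)).re -
      (z s).re * (Real.pi • gradient G (z s)).im)
    (((him hz).mul (hre (hgrad.comp hz))).sub ((hre hz).mul (him (hgrad.comp hz)))) θ₀.toReal
  refine ⟨fun c => α c.1, rotCylinder p θ z,
    ⟨isPseudoholomorphic_rotCylinder p hG hα hθ hz hα' hz' hθ',
      hoferEnergy_rotCylinder_lt_top p hG hG1 hα hθ hz hα' hz' hθ'⟩, ⟨(0, 0), ?_⟩,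
    iUnion_limitSet_rotCylinder p hG hcrit ht hb hp hm⟩
  simp [rotCylinder, hθ0]
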